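/- **Theorem 2.** For $m\in\{0,1,2,\dots\}$ let $$V_m(x)=\frac1{m!}\int_0^\infty \frac{s^{2m}e^{-s^2}}{\sqrt{x^2+s^2}}\,s\,ds ,\qquad V_{-1}(x)=\frac1{|x|}.$$ For $N$ particles on the line, $Z\ge 1$, $B>0$ and real measurable potentials $\widetilde V_j$ ($1\le j\le N$) and $\widetilde W_{jk}$ ($1\le j<k\le N$), with $\widetilde V_j\in L^1_{\rm loc}(\mathbb R)$ and $\widetilde W_{jk}\in L^1_{\rm loc}(\mathbb R\setminus\{0\})$, consider $$h=\sum_{j=1}^N\Big[-\frac1M\frac{d^2}{dx_j^2}-Z\,\widetilde V_j(x_j)\Big]+\sum_{j<k}\widetilde W_{jk}(x_j-x_k),\qquad M=B^{-1/2}.$$ Let $E_0(N)=\inf\langle\Phi,h\Phi\rangle$, the infimum being over normalized $\Phi\in C_c^\infty(\mathbb R^N;\mathbb C)$ with finite potential energy, and let $E_0^{(k)}(N-1)$ be the corresponding ground state energy of the $(N-1)$-particle Hamiltonian obtained from $h$ by omitting all terms involving $x_k$ (for identical potentials it does not depend on $k$). We say that $h$ has a bound state if $E_0(N)<E_0^{(k)}(N-1)$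 for every $k$. Let $K,\gamma\in\mathbb R$. There are constants $A,a_2>0$ depending only on $K$ and $\gamma$, and for every $\epsilon>0$ a constant $a_\epsilon>0$ depending only on $K,\gamma,\epsilon$, such that the following holds for all integers $N\ge 0$, $\mu\ge0$, $0\le\nu\le2\mu$, all real $Z\ge1$ and $B$, and all potentials as above. Suppose that $$\widetilde V_j(x)\le V_\mu(x)\quad\text{and}\quad \widetilde W_{jk}(x)\ge \tfrac1{\sqrt2}V_{\nu-1}\big(\tfrac{x}{\sqrt2}\big)\qquad\text{for all } j,\ \text{all } j<k \text{ and all } x$$ (only $x\neq0$ in the second bound), and that either $\nu\le K$ and $\gamma>2$, or $\nu\le KN$ and $\gamma>3$. If $$N>3Z+1+A\,Z\log Z\,\Big|\log\frac{Z^2}{B}\Big|\qquad\text{and}\qquad a_\epsilon e^{Z^{1/2-\epsilon}}>B\ge a_2Z^{\gamma},$$ then $h$ has no bound state. -/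

import Mathlib

open MeasureTheory
open scoped ContDiff

noncomputable section

namespace LandauModel

/-- The regularized Coulomb potential
`V_m(x) = (1/m!) ∫₀^∞ s^{2m} e^{-s²} / √(x² + s²) s ds` of the `m`-th Landau state. -/
def V (m : ℕ) (x : ℝ) : ℝ :=
  (1 / (m.factorial : ℝ)) *
    ∫ s in Set.Ioi (0 : ℝ), s ^ (2 * m) * Real.exp (-s ^ 2) / Real.sqrt (x ^ 2 + s ^ 2) * s

/-- `VPred ν = V_{ν-1}`.  For `ν = 0` this is the unregularized Coulomb potential `1/|x|`, the limit
of `V_m` (with `Γ(m+1)` in place of `m!`) as the real parameter `m` decreases to `-1`. -/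
def VPred : ℕ → ℝ → ℝ
  | 0, x => 1 / |x|
  | m + 1, x => V m x

section Hamiltonian

variable {ι : Type} [Fintype ι] [LinearOrder ι]

/-- The potential `-Z ∑_j V_j(x_j) + ∑_{j<k} W_{jk}(x_j - x_k)` on the configuration space
of the particles labelled by `ι`. -/
def potential (Z : ℝ) (Vt : ι → ℝ → ℝ) (Wt : ι → ι → ℝ → ℝ) (x : ι → ℝ) : ℝ :=
  (∑ j, -Z * Vt j (x j)) + ∑ j, ∑ k ∈ Finset.univ.filter (fun k => j < k), Wt j k (x j - x k)

/-- The quadratic form `⟨Φ, h Φ⟩` of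
`h = ∑_j [-(1/M) d²/dx_j² - Z V_j(x_j)] + ∑_{j<k} W_{jk}(x_j - x_k)`. -/
def energy (M Z : ℝ) (Vt : ι → ℝ → ℝ) (Wt : ι → ι → ℝ → ℝ) (Φ : (ι → ℝ) → ℂ) : ℝ :=
  ∫ x, ((1 / M) * ∑ j, ‖fderiv ℝ Φ x (Pi.single j 1)‖ ^ 2
    + potential Z Vt Wt x * ‖Φ x‖ ^ 2)

/-- Normalized smooth compactly supported wave functions of finite potential energy. -/
structure IsTrial (Z : ℝ) (Vt : ι → ℝ → ℝ) (Wt : ι → ι → ℝ → ℝ) (Φ : (ι → ℝ) → ℂ) : Prop where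
  contDiff : ContDiff ℝ ∞ Φ
  hasCompactSupport : HasCompactSupport Φ
  integrable : Integrable (fun x => potential Z Vt Wt x * ‖Φ x‖ ^ 2)
  norm_eq_one : ∫ x, ‖Φ x‖ ^ 2 = 1

/-- The ground state energy `inf_{‖Φ‖ = 1} ⟨Φ, h Φ⟩`, valued in the extended reals so that no
junk value can occur.  For an empty `ι` it is `0`. -/
def groundEnergy (M Z : ℝ) (Vt : ι → ℝ → ℝ) (Wt : ι → ι → ℝ → ℝ) : EReal :=
  ⨅ (Φ : (ι → ℝ) → ℂ) (_ : IsTrial Z Vt Wt Φ), (energy M Z Vt Wt Φ : EReal)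

/-- The ground state energy of the Hamiltonian obtained by omitting all terms that involve `x_k`. -/
def groundEnergyWithout (M Z : ℝ) (Vt : ι → ℝ → ℝ) (Wt : ι → ι → ℝ → ℝ) (k : ι) : EReal :=
  groundEnergy (ι := {j : ι // j ≠ k}) M Z (fun j => Vt j) (fun i j => Wt i j)

/-- `h` has a bound state: its ground state energy lies strictly below the ground state energy
that is left after removing any one of the particles, `E₀(N) < E₀(N-1)`. -/
def HasBoundState (M Z : ℝ) (Vt : ι → ℝ → ℝ) (Wt : ι → ι → ℝ → ℝ) : Prop :=
  ∀ k : ι, groundEnergy M Z Vt Wt < groundEnergyWithout M Z Vt Wt k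

end Hamiltonian

end LandauModel

end

/-! The proof is a Lieb-type localization argument with a kinetic term to tame the attraction. Put
`b = 1/M = √B` and `w(x) = √(R² + x²)`. A trial function is written `Φ = √S Ψ` with `S = ∑ w(x_k)`,
and cut into the pieces `ψ_k = √w(x_k) Ψ`, so that `∑ ‖ψ_k‖² = ‖Φ‖²`. By `sum_norm_fderiv_sq_le`
this cutting costs at most `N b/(4R) ‖Ψ‖²`.

In `ψ_k` the particle `k` is removed. The others contribute at least the `(N-1)`-particle energy, by
slicing (`mul_integral_le_of_le_groundEnergyWithout`). What remains is the kinetic energy of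
particle `k` and the potential terms containing `x_k`. The kinetic energy dominates `b (g' - g²)`
for any `C¹` function `g` (`integral_riccati_le`). The choice `g = (2Z/b) damp R` cancels the
attraction up to `4Zl + 4Z²l²R/b` after multiplication by `w`, where `l = log(2R+1)`
(`weight_mul_attraction_le`). Each pair receives its repulsion with the factor `w(x_j) + w(x_l)`,
which is at least `1/2` in total as soon as `2ν ≤ 4R²` (`half_le_weight_add_weight_mul`). The
repulsion therefore gives `N(N-1)/4`, and there is no binding if `b/R + 16Zl + 16Z²l²R/b ≤ N - 1`
(`not_hasBoundState_of_card_ge`).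

The scale `R = 4b/N + 1 + √ν` meets this condition: the logarithm in the lower bound on `N` controls
`l`, and the power of `Z` in the lower bound on `B` controls the contribution of `√ν`. The
exponential upper bound on `B` serves only to force `Z > 4`, hence `log Z ≥ 1`; its constant can be
chosen independent of `ε`. -/

namespace LandauModel

/-! ### Bounds on the regularized Coulomb potentials -/

section SpecialFunctions

lemma integrableOn_pow_mul_exp_neg_sq (n : ℕ) :
    IntegrableOn (fun s : ℝ => s ^ n * Real.exp (-s ^ 2)) (Set.Ioi 0) := by
  have h := integrableOn_rpow_mul_exp_neg_rpow (p := 2) (s := (n : ℝ))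
    (by have : (0 : ℝ) ≤ n := n.cast_nonneg
        linarith) (by norm_num)
  refine h.congr_fun (fun s _ => ?_) measurableSet_Ioi
  simp [Real.rpow_natCast]

lemma integral_pow_mul_exp_neg_sq (n : ℕ) :
    ∫ s in Set.Ioi (0 : ℝ), s ^ n * Real.exp (-s ^ 2) = Real.Gamma ((n + 1) / 2) / 2 := by
  have h := integral_rpow_mul_exp_neg_rpow (p := 2) (q := (n : ℝ)) (by norm_num)
    (by have : (0 : ℝ) ≤ n := n.cast_nonneg
        linarith)
  rw [div_eq_inv_mul _ (2 : ℝ), ← one_div, ← h]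
  refine setIntegral_congr_fun measurableSet_Ioi (fun s _ => ?_)
  simp [Real.rpow_natCast]

lemma integral_odd_pow_mul_exp_neg_sq (m : ℕ) :
    ∫ s in Set.Ioi (0 : ℝ), s ^ (2 * m + 1) * Real.exp (-s ^ 2) = m.factorial / 2 := by
  rw [integral_pow_mul_exp_neg_sq, ← Real.Gamma_nat_eq_factorial]
  congr 2
  push_cast
  ring

lemma Gamma_nat_add_half_le (m : ℕ) : Real.Gamma (m + 1 / 2) ≤ 2 * m.factorial := by
  induction m with
  | zero =>
    simp only [Nat.cast_zero, zero_add, Real.Gamma_one_half_eq, Nat.factorial_zero, Nat.cast_one,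
      mul_one]
    rw [Real.sqrt_le_left (by norm_num)]
    linarith [Real.pi_lt_four]
  | succ m ih =>
    have hm : (0 : ℝ) ≤ m := m.cast_nonneg
    have h : ((m + 1 : ℕ) : ℝ) + 1 / 2 = (m + 1 / 2) + 1 := by push_cast; ring
    rw [h, Real.Gamma_add_one (by positivity), Nat.factorial_succ]
    push_cast
    have : (0 : ℝ) ≤ m.factorial := by positivity
    nlinarith

lemma integral_even_pow_mul_exp_neg_sq_le (m : ℕ) :
    ∫ s in Set.Ioi (0 : ℝ), s ^ (2 * m) * Real.exp (-s ^ 2) ≤ m.factorial := by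
  rw [integral_pow_mul_exp_neg_sq]
  have h : (((2 * m : ℕ) : ℝ) + 1) / 2 = m + 1 / 2 := by push_cast; ring
  rw [h]
  linarith [Gamma_nat_add_half_le m]

lemma integrableOn_V (m : ℕ) (x : ℝ) :
    IntegrableOn (fun s : ℝ => s ^ (2 * m) * Real.exp (-s ^ 2) / Real.sqrt (x ^ 2 + s ^ 2) * s)
      (Set.Ioi 0) := by
  refine (integrableOn_pow_mul_exp_neg_sq (2 * m)).mono' ?_ ?_
  · exact (by fun_prop : Measurable _).aestronglyMeasurable
  · refine (ae_restrict_mem measurableSet_Ioi).mono (fun s hs => ?_)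
    have hs : 0 < s := hs
    have hr : s ≤ Real.sqrt (x ^ 2 + s ^ 2) := Real.le_sqrt_of_sq_le (by nlinarith [sq_nonneg x])
    have hr0 : 0 < Real.sqrt (x ^ 2 + s ^ 2) := lt_of_lt_of_le hs hr
    rw [Real.norm_of_nonneg (by positivity), div_mul_eq_mul_div, div_le_iff₀ hr0]
    gcongr

/-- Pointwise, `s/√(x²+s²) ≤ (s+1)/√(1+x²)`, and the two resulting moments are at most `m!/2` and
`m!`. The bound is uniform in `m`, so `μ` disappears from the problem. -/
lemma V_le (m : ℕ) (x : ℝ) : V m x ≤ 2 / Real.sqrt (1 + x ^ 2) := by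
  have hf : (0 : ℝ) < m.factorial := by positivity
  have hx : 0 < Real.sqrt (1 + x ^ 2) := Real.sqrt_pos.2 (by positivity)
  have hint : ∫ s in Set.Ioi (0 : ℝ),
      s ^ (2 * m) * Real.exp (-s ^ 2) / Real.sqrt (x ^ 2 + s ^ 2) * s ≤
      ∫ s in Set.Ioi (0 : ℝ), (s ^ (2 * m + 1) * Real.exp (-s ^ 2)
        + s ^ (2 * m) * Real.exp (-s ^ 2)) / Real.sqrt (1 + x ^ 2) := by
    refine setIntegral_mono_on (integrableOn_V m x)
      (((integrableOn_pow_mul_exp_neg_sq _).add (integrableOn_pow_mul_exp_neg_sq _)).div_const _)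
      measurableSet_Ioi (fun s hs => ?_)
    have hs : 0 < s := hs
    have hr0 : 0 < Real.sqrt (x ^ 2 + s ^ 2) := Real.sqrt_pos.2 (by positivity)
    have key : s * Real.sqrt (1 + x ^ 2) ≤ (s + 1) * Real.sqrt (x ^ 2 + s ^ 2) := by
      rw [← Real.sqrt_sq (by positivity : 0 ≤ s + 1), ← Real.sqrt_mul (by positivity)]
      nth_rewrite 1 [← Real.sqrt_sq hs.le]
      rw [← Real.sqrt_mul (by positivity)]
      apply Real.sqrt_le_sqrt
      nlinarith [sq_nonneg x, mul_pos hs hs, sq_nonneg (s * x), mul_nonneg hs.le (sq_nonneg x),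
        sq_nonneg (s ^ 2), pow_pos hs 3]
    rw [le_div_iff₀ hx, div_mul_eq_mul_div, div_mul_eq_mul_div, div_le_iff₀ hr0]
    have hw : 0 ≤ s ^ (2 * m) * Real.exp (-s ^ 2) := by positivity
    calc s ^ (2 * m) * Real.exp (-s ^ 2) * s * Real.sqrt (1 + x ^ 2)
        = s ^ (2 * m) * Real.exp (-s ^ 2) * (s * Real.sqrt (1 + x ^ 2)) := by ring
      _ ≤ s ^ (2 * m) * Real.exp (-s ^ 2) * ((s + 1) * Real.sqrt (x ^ 2 + s ^ 2)) := by gcongr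
      _ = _ := by ring
  rw [integral_div, integral_add (integrableOn_pow_mul_exp_neg_sq _)
    (integrableOn_pow_mul_exp_neg_sq _), integral_odd_pow_mul_exp_neg_sq] at hint
  have h2 := integral_even_pow_mul_exp_neg_sq_le m
  unfold V
  rw [one_div, inv_mul_le_iff₀ hf]
  refine hint.trans ?_
  rw [mul_div_assoc', div_le_div_iff_of_pos_right hx]
  linarith

/-- The convex function `t ↦ t^(-1/2)` lies above its tangent at `T`. With `a = √t`, `c = √T` this
is `(a + 2c)(a - c)² ≥ 0`. -/
lemma inv_sqrt_tangent {t T : ℝ} (ht : 0 < t) (hT : 0 < T) :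
    (3 * T - t) / (2 * T * Real.sqrt T) ≤ 1 / Real.sqrt t := by
  have h1 := Real.sqrt_pos.2 ht
  have h2 := Real.sqrt_pos.2 hT
  rw [div_le_div_iff₀ (by positivity) h1]
  set a := Real.sqrt t
  set c := Real.sqrt T
  have ha : t = a ^ 2 := (Real.sq_sqrt ht.le).symm
  have hc : T = c ^ 2 := (Real.sq_sqrt hT.le).symm
  rw [ha, hc]
  nlinarith [mul_nonneg (by positivity : 0 ≤ a + 2 * c) (sq_nonneg (a - c))]

/-- Jensen's inequality: under the probability density `(2/m!) s^(2m+1) e^(-s²)` the mean of `s²` is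
`m + 1`, so the tangent is taken at `T = y² + m + 1`. -/
lemma le_V (m : ℕ) (y : ℝ) : 1 / (2 * Real.sqrt (y ^ 2 + (m + 1))) ≤ V m y := by
  have hf : (0 : ℝ) < m.factorial := by positivity
  set T : ℝ := y ^ 2 + (m + 1) with hTdef
  have hT : 0 < T := by positivity
  have hT' := Real.sqrt_pos.2 hT
  have hint : ∫ s in Set.Ioi (0 : ℝ), ((3 * T - y ^ 2) * (s ^ (2 * m + 1) * Real.exp (-s ^ 2))
        - s ^ (2 * (m + 1) + 1) * Real.exp (-s ^ 2)) / (2 * T * Real.sqrt T) ≤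
      ∫ s in Set.Ioi (0 : ℝ),
        s ^ (2 * m) * Real.exp (-s ^ 2) / Real.sqrt (y ^ 2 + s ^ 2) * s := by
    refine setIntegral_mono_on ((((integrableOn_pow_mul_exp_neg_sq _).const_mul _).sub
      (integrableOn_pow_mul_exp_neg_sq _)).div_const _) (integrableOn_V m y)
      measurableSet_Ioi (fun s hs => ?_)
    have hs : 0 < s := hs
    have h := inv_sqrt_tangent (by positivity : 0 < y ^ 2 + s ^ 2) hT
    have hw : 0 ≤ s ^ (2 * m + 1) * Real.exp (-s ^ 2) := by positivity
    calc _ = s ^ (2 * m + 1) * Real.exp (-s ^ 2) *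
          ((3 * T - (y ^ 2 + s ^ 2)) / (2 * T * Real.sqrt T)) := by ring
      _ ≤ s ^ (2 * m + 1) * Real.exp (-s ^ 2) * (1 / Real.sqrt (y ^ 2 + s ^ 2)) := by gcongr
      _ = _ := by ring
  rw [integral_div, integral_sub ((integrableOn_pow_mul_exp_neg_sq _).const_mul _)
    (integrableOn_pow_mul_exp_neg_sq _), integral_const_mul, integral_odd_pow_mul_exp_neg_sq,
    integral_odd_pow_mul_exp_neg_sq, Nat.factorial_succ] at hint
  unfold V
  rw [one_div (m.factorial : ℝ), ← div_eq_inv_mul, le_div_iff₀ hf]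
  refine le_trans (le_of_eq ?_) hint
  push_cast
  rw [show 3 * T - y ^ 2 = 2 * T + (m + 1) by rw [hTdef]; ring]
  field_simp
  ring

lemma le_VPred (n : ℕ) {x : ℝ} (hx : x ≠ 0) :
    1 / (2 * Real.sqrt (x ^ 2 + 2 * n)) ≤ (1 / Real.sqrt 2) * VPred n (x / Real.sqrt 2) := by
  have h2 : 0 < Real.sqrt 2 := by positivity
  cases n with
  | zero =>
    have hx' : 0 < |x| := abs_pos.2 hx
    simp only [VPred, Nat.cast_zero, mul_zero, add_zero, Real.sqrt_sq_eq_abs, abs_div,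
      abs_of_pos h2]
    rw [show 1 / Real.sqrt 2 * (1 / (|x| / Real.sqrt 2)) = 1 / |x| by field_simp]
    exact one_div_le_one_div_of_le hx' (by linarith)
  | succ m =>
    have h := le_V m (x / Real.sqrt 2)
    simp only [VPred]
    calc 1 / (2 * Real.sqrt (x ^ 2 + 2 * ((m + 1 : ℕ) : ℝ)))
        = (1 / Real.sqrt 2) * (1 / (2 * Real.sqrt ((x / Real.sqrt 2) ^ 2 + (m + 1)))) := by
          rw [one_div_mul_one_div]
          congr 1
          have : x ^ 2 + 2 * ((m + 1 : ℕ) : ℝ) = 2 * ((x / Real.sqrt 2) ^ 2 + (m + 1)) := by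
            rw [div_pow, Real.sq_sqrt (by norm_num)]; push_cast; ring
          rw [this, Real.sqrt_mul (by norm_num)]
          ring
      _ ≤ _ := by gcongr

end SpecialFunctions

/-! ### The localization weight and the pair repulsion -/

section Weight

/-- The one-particle localization weight `√(R² + x²)`. -/
noncomputable def weight (R x : ℝ) : ℝ := Real.sqrt (R ^ 2 + x ^ 2)

/-- The square root of the localization weight. -/
noncomputable def weightRoot (R x : ℝ) : ℝ := Real.sqrt (weight R x)

variable {R : ℝ}

lemma weight_sq (R x : ℝ) : weight R x ^ 2 = R ^ 2 + x ^ 2 := Real.sq_sqrt (by positivity)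

lemma weight_pos (hR : 0 < R) (x : ℝ) : 0 < weight R x := Real.sqrt_pos.2 (by positivity)

lemma le_weight (R x : ℝ) : R ≤ weight R x := Real.le_sqrt_of_sq_le (by nlinarith [sq_nonneg x])

lemma abs_le_weight (R x : ℝ) : |x| ≤ weight R x :=
  Real.abs_le_sqrt (by nlinarith [sq_nonneg R])

lemma contDiff_weight (hR : 0 < R) {n : WithTop ℕ∞} : ContDiff ℝ n (weight R) :=
  (contDiff_const.add (contDiff_id.pow 2)).sqrt
    (fun x => (by positivity : 0 < R ^ 2 + x ^ 2).ne')

lemma hasDerivAt_weight (hR : 0 < R) (x : ℝ) :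
    HasDerivAt (weight R) (x / weight R x) x := by
  have h : HasDerivAt (fun x : ℝ => R ^ 2 + x ^ 2) (2 * x) x := by
    simpa using (hasDerivAt_pow 2 x).const_add (R ^ 2)
  exact (h.sqrt (by positivity : R ^ 2 + x ^ 2 ≠ 0)).congr_deriv
    (mul_div_mul_left _ _ two_ne_zero)

lemma weightRoot_pos (hR : 0 < R) (x : ℝ) : 0 < weightRoot R x :=
  Real.sqrt_pos.2 (weight_pos hR x)

lemma weightRoot_sq (hR : 0 < R) (x : ℝ) : weightRoot R x ^ 2 = weight R x :=
  Real.sq_sqrt (weight_pos hR x).le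

lemma contDiff_weightRoot (hR : 0 < R) {n : WithTop ℕ∞} : ContDiff ℝ n (weightRoot R) :=
  (contDiff_weight hR).sqrt (fun x => (weight_pos hR x).ne')

lemma hasDerivAt_weightRoot (hR : 0 < R) (x : ℝ) :
    HasDerivAt (weightRoot R) (x / weight R x / (2 * weightRoot R x)) x :=
  (hasDerivAt_weight hR x).sqrt (weight_pos hR x).ne'

lemma deriv_weightRoot_sq_le (hR : 0 < R) (x : ℝ) : deriv (weightRoot R) x ^ 2 ≤ 1 / (4 * R) := by
  have hw := weight_pos hR x
  have hq := weightRoot_pos hR x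
  rw [(hasDerivAt_weightRoot hR x).deriv, div_pow, mul_pow, weightRoot_sq hR]
  have h1 : (x / weight R x) ^ 2 ≤ 1 := by
    rw [div_pow, div_le_one (by positivity), weight_sq]
    nlinarith [sq_nonneg R]
  rw [div_le_div_iff₀ (by positivity) (by positivity)]
  nlinarith [le_weight R x]

/-- By Cauchy–Schwarz `w(x) w(y) ≥ R² + |x||y|`, hence `(w(x) + w(y))² ≥ 4R² + (|x| + |y|)² ≥ t + (x
- y)²`. -/
lemma half_le_weight_add_weight_mul {t : ℝ} (ht : 0 ≤ t) (htR : t ≤ 4 * R ^ 2) (hR : 0 < R)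
    {x y : ℝ} (hxy : x - y ≠ 0) :
    1 / 2 ≤ (weight R x + weight R y) * (1 / (2 * Real.sqrt ((x - y) ^ 2 + t))) := by
  have hx := weight_pos hR x
  have hy := weight_pos hR y
  have hs : 0 < Real.sqrt ((x - y) ^ 2 + t) := Real.sqrt_pos.2 (by positivity)
  have key : Real.sqrt ((x - y) ^ 2 + t) ≤ weight R x + weight R y := by
    rw [Real.sqrt_le_left (by positivity)]
    have hprod : R ^ 2 + |x| * |y| ≤ weight R x * weight R y := by
      refine abs_le_of_sq_le_sq' ?_ (by positivity) |>.2
      rw [mul_pow, weight_sq, weight_sq]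
      nlinarith [sq_nonneg (R * (|x| - |y|)), sq_abs x, sq_abs y]
    have : -(x * y) ≤ |x| * |y| := by rw [← abs_mul]; exact neg_le_abs _
    nlinarith [weight_sq R x, weight_sq R y]
  rw [mul_one_div, div_le_div_iff₀ (by norm_num) (by positivity)]
  linarith

end Weight

/-! ### The comparison function that absorbs the attraction -/

section Damping

/-- A bounded primitive-like comparison function for `1 / √(1 + x²)`, decaying beyond scale `R`. -/
noncomputable def damp (R x : ℝ) : ℝ := Real.arsinh x * (R ^ 2 / (R ^ 2 + x ^ 2))

variable {R : ℝ}

lemma hasDerivAt_damp (hR : 0 < R) (x : ℝ) :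
    HasDerivAt (damp R) ((Real.sqrt (1 + x ^ 2))⁻¹ * (R ^ 2 / (R ^ 2 + x ^ 2))
      + Real.arsinh x * (-(R ^ 2 * (2 * x)) / (R ^ 2 + x ^ 2) ^ 2)) x := by
  have h : HasDerivAt (fun x : ℝ => R ^ 2 + x ^ 2) (2 * x) x := by
    simpa using (hasDerivAt_pow 2 x).const_add (R ^ 2)
  have h2 := (hasDerivAt_const x (R ^ 2)).div h (by positivity : R ^ 2 + x ^ 2 ≠ 0)
  exact ((Real.hasDerivAt_arsinh x).mul h2).congr_deriv (by simp)

lemma contDiff_damp (hR : 0 < R) {n : WithTop ℕ∞} : ContDiff ℝ n (damp R) :=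
  Real.contDiff_arsinh.mul (contDiff_const.div (contDiff_const.add (contDiff_id.pow 2))
    (fun x => (by positivity : 0 < R ^ 2 + x ^ 2).ne'))

lemma one_le_log_two_mul_add_one (hR : 1 ≤ R) : 1 ≤ Real.log (2 * R + 1) := by
  rw [Real.le_log_iff_exp_le (by positivity)]
  linarith [Real.exp_one_lt_d9]

/-- With `l = log(2R+1) ≥ 1` and `q = w/R ≥ 1`, the argument of the logarithm is at most `(2R+1) q`,
and `l + log q ≤ l + q - 1 ≤ l q`. -/
lemma abs_arsinh_le (hR : 1 ≤ R) (x : ℝ) :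
    |Real.arsinh x| ≤ Real.log (2 * R + 1) * weight R x / R := by
  have hR0 : 0 < R := by linarith
  have hw := weight_pos hR0 x
  have hl := one_le_log_two_mul_add_one hR
  have habs : |Real.arsinh x| = Real.arsinh |x| := by
    rcases le_total 0 x with h | h
    · rw [abs_of_nonneg h, abs_of_nonneg (Real.arsinh_nonneg_iff.2 h)]
    · rw [abs_of_nonpos h, abs_of_nonpos (Real.arsinh_nonpos_iff.2 h), Real.arsinh_neg]
  have hq : 1 ≤ weight R x / R := (one_le_div hR0).2 (le_weight R x)
  have h1 : |x| + Real.sqrt (1 + |x| ^ 2) ≤ (2 * R + 1) * (weight R x / R) := by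
    have : Real.sqrt (1 + |x| ^ 2) ≤ 1 + |x| := by
      rw [Real.sqrt_le_left (by positivity)]
      nlinarith [abs_nonneg x]
    have h3 : (2 * R + 1) * (weight R x / R) = 2 * weight R x + weight R x / R := by
      field_simp
    linarith [abs_le_weight R x]
  rw [habs, Real.arsinh]
  calc Real.log (|x| + Real.sqrt (1 + |x| ^ 2))
      ≤ Real.log ((2 * R + 1) * (weight R x / R)) := Real.log_le_log (by positivity) h1
    _ = Real.log (2 * R + 1) + Real.log (weight R x / R) :=
        Real.log_mul (by positivity) (by positivity)
    _ ≤ Real.log (2 * R + 1) + (weight R x / R - 1) := by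
        gcongr
        exact Real.log_le_sub_one_of_pos (by positivity)
    _ ≤ _ := by
        rw [mul_div_assoc]
        nlinarith

/-- The derivative of `damp` cancels `1/√(1+x²)` up to a remainder carrying `x²/w²`; that remainder
and the derivative of the cutoff each cost at most `l` after multiplication by the weight. -/
lemma weight_mul_sub_deriv_damp_le (hR : 1 ≤ R) (x : ℝ) :
    weight R x * (1 / Real.sqrt (1 + x ^ 2) - deriv (damp R) x) ≤ 2 * Real.log (2 * R + 1) := by
  have hR0 : 0 < R := by linarith
  have hw := weight_pos hR0 x
  have hl := one_le_log_two_mul_add_one hR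
  have hs : 0 < Real.sqrt (1 + x ^ 2) := Real.sqrt_pos.2 (by positivity)
  have hxs : |x| ≤ Real.sqrt (1 + x ^ 2) := Real.abs_le_sqrt (by linarith)
  have hA := abs_arsinh_le hR x
  rw [(hasDerivAt_damp hR0 x).deriv, ← weight_sq]
  set w := weight R x with hwdef
  set l := Real.log (2 * R + 1)
  have hw2 : R ^ 2 = w ^ 2 - x ^ 2 := by rw [hwdef, weight_sq]; ring
  have e1 : w * (1 / Real.sqrt (1 + x ^ 2) - ((Real.sqrt (1 + x ^ 2))⁻¹ * (R ^ 2 / w ^ 2)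
      + Real.arsinh x * (-(R ^ 2 * (2 * x)) / (w ^ 2) ^ 2))) =
      x ^ 2 / (w * Real.sqrt (1 + x ^ 2)) + 2 * R ^ 2 * (x * Real.arsinh x) / w ^ 3 := by
    have : R ^ 2 / w ^ 2 = 1 - x ^ 2 / w ^ 2 := by rw [hw2]; field_simp
    rw [this]
    field_simp
    ring
  rw [e1]
  have t1 : x ^ 2 / (w * Real.sqrt (1 + x ^ 2)) ≤ 1 := by
    rw [div_le_one (by positivity)]
    calc x ^ 2 = |x| * |x| := by rw [abs_mul_abs_self, sq]
      _ ≤ _ := mul_le_mul (abs_le_weight R x) hxs (abs_nonneg _) hw.le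
  have t2 : 2 * R ^ 2 * (x * Real.arsinh x) / w ^ 3 ≤ l := by
    have hxA : x * Real.arsinh x ≤ |x| * (l * w / R) :=
      (le_abs_self _).trans (by rw [abs_mul]; gcongr)
    have hRx : 2 * (R * |x|) ≤ w ^ 2 := by
      have := sq_nonneg (R - |x|)
      have h := sq_abs x
      nlinarith
    rw [div_le_iff₀ (by positivity)]
    calc 2 * R ^ 2 * (x * Real.arsinh x) ≤ 2 * R ^ 2 * (|x| * (l * w / R)) := by gcongr
      _ = l * w * (2 * (R * |x|)) := by field_simp
      _ ≤ l * w * w ^ 2 := by gcongr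
      _ = _ := by ring
  linarith

lemma weight_mul_damp_sq_le (hR : 1 ≤ R) (x : ℝ) :
    weight R x * damp R x ^ 2 ≤ Real.log (2 * R + 1) ^ 2 * R := by
  have hR0 : 0 < R := by linarith
  have hw := weight_pos hR0 x
  have hl := one_le_log_two_mul_add_one hR
  have hA := abs_arsinh_le hR x
  rw [damp, ← weight_sq]
  set w := weight R x with hwdef
  set l := Real.log (2 * R + 1)
  have hA2 : Real.arsinh x ^ 2 ≤ (l * w / R) ^ 2 := sq_le_sq' (abs_le.1 hA).1 (abs_le.1 hA).2
  calc w * (Real.arsinh x * (R ^ 2 / w ^ 2)) ^ 2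
      = Real.arsinh x ^ 2 * (R ^ 4 / w ^ 3) := by field_simp
    _ ≤ (l * w / R) ^ 2 * (R ^ 4 / w ^ 3) := by gcongr
    _ = l ^ 2 * R * (R / w) := by field_simp
    _ ≤ l ^ 2 * R * 1 := by
        gcongr
        exact (div_le_one hw).2 (le_weight R x)
    _ = _ := by ring

/-- Comparison of the attraction `2 * Z / √(1 + x²)`, weighted by `weight R x`, with the potential
`b (g' - g²)` that the kinetic energy dominates, for `g = (2 * Z/b) damp R`. -/
lemma weight_mul_attraction_le {b Z : ℝ} (hb : 0 < b) (hZ : 0 ≤ Z) (hR : 1 ≤ R) (x : ℝ) :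
    weight R x * (Z * (2 / Real.sqrt (1 + x ^ 2))
      - b * (deriv (fun y => 2 * Z / b * damp R y) x - (2 * Z / b * damp R x) ^ 2)) ≤
      4 * Z * Real.log (2 * R + 1) + 4 * Z ^ 2 * Real.log (2 * R + 1) ^ 2 * R / b := by
  have hR0 : 0 < R := by linarith
  rw [deriv_const_mul _ (hasDerivAt_damp hR0 x).differentiableAt]
  calc _ = 2 * Z * (weight R x * (1 / Real.sqrt (1 + x ^ 2) - deriv (damp R) x))
        + 4 * Z ^ 2 / b * (weight R x * damp R x ^ 2) := by field_simp; ring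
    _ ≤ 2 * Z * (2 * Real.log (2 * R + 1))
        + 4 * Z ^ 2 / b * (Real.log (2 * R + 1) ^ 2 * R) := by
        exact add_le_add
          (mul_le_mul_of_nonneg_left (weight_mul_sub_deriv_damp_le hR x) (by positivity))
          (mul_le_mul_of_nonneg_left (weight_mul_damp_sq_le hR x) (by positivity))
    _ = _ := by ring

end Damping

/-! ### Localization error -/

section Localization

variable {ι : Type} [Fintype ι] {R : ℝ}

/-- The total weight of a configuration. -/
noncomputable def totalWeight (R : ℝ) (x : ι → ℝ) : ℝ := ∑ k, weight R (x k)

lemma totalWeight_pos [Nonempty ι] (hR : 0 < R) (x : ι → ℝ) : 0 < totalWeight R x :=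
  Finset.sum_pos (fun k _ => weight_pos hR (x k)) Finset.univ_nonempty

lemma contDiff_comp_eval {g : ℝ → ℝ} {n : WithTop ℕ∞} (hg : ContDiff ℝ n g) (k : ι) :
    ContDiff ℝ n (fun x : ι → ℝ => g (x k)) :=
  hg.comp (contDiff_apply ℝ ℝ k)

lemma contDiff_totalWeight (hR : 0 < R) {n : WithTop ℕ∞} :
    ContDiff ℝ n (totalWeight R : (ι → ℝ) → ℝ) :=
  ContDiff.sum (fun k _ => contDiff_comp_eval (contDiff_weight hR) k)

variable [LinearOrder ι]

lemma fderiv_comp_eval_single {g : ℝ → ℝ} {x : ι → ℝ} {k : ι} (hg : DifferentiableAt ℝ g (x k))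
    (j : ι) : fderiv ℝ (fun x : ι → ℝ => g (x k)) x (Pi.single j 1) =
      if k = j then deriv g (x j) else 0 := by
  have h : HasFDerivAt (fun x : ι → ℝ => g (x k)) _ x :=
    hg.hasDerivAt.comp_hasFDerivAt x ((ContinuousLinearMap.proj (R := ℝ) (φ := fun _ : ι => ℝ) k).hasFDerivAt)
  rw [h.fderiv]
  by_cases hkj : k = j
  · subst hkj; simp
  · simp [hkj]

lemma fderiv_totalWeight_single (hR : 0 < R) (x : ι → ℝ) (j : ι) :
    fderiv ℝ (totalWeight R) x (Pi.single j 1) = deriv (weight R) (x j) := by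
  have hd : ∀ y, DifferentiableAt ℝ (weight R) y :=
    fun y => (hasDerivAt_weight hR y).differentiableAt
  have : (totalWeight R : (ι → ℝ) → ℝ) = fun x => ∑ k, weight R (x k) := rfl
  rw [this, fderiv_fun_sum (fun k _ => (contDiff_comp_eval (contDiff_weight hR (n := 1)) k
    |>.differentiable one_ne_zero) x), sum_apply,
    Finset.sum_congr rfl (fun k _ => fderiv_comp_eval_single (hd (x k)) j)]
  simp

lemma norm_smul_add_smul_sq (a c : ℝ) (u v : ℂ) :
    ‖a • u + c • v‖ ^ 2 = a ^ 2 * ‖u‖ ^ 2 + 2 * (a * c) * inner ℝ u v + c ^ 2 * ‖v‖ ^ 2 := by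
  rw [norm_add_sq_real, norm_smul, norm_smul, inner_smul_left, inner_smul_right, mul_pow, mul_pow,
    Real.norm_eq_abs, Real.norm_eq_abs, sq_abs, sq_abs]
  simp only [conj_trivial]
  ring

/-- Localization error: the kinetic energy densities of the pieces `√(weight) Ψ` exceed that of the
recombined function by at most the squared gradient of the localization. -/
lemma sum_norm_fderiv_sq_le [Nonempty ι] (hR : 0 < R) {Ψ : (ι → ℝ) → ℂ} {x : ι → ℝ}
    (hΨ : DifferentiableAt ℝ Ψ x) (j : ι) :
    ∑ k, ‖fderiv ℝ (fun x => weightRoot R (x k) • Ψ x) x (Pi.single j 1)‖ ^ 2 ≤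
      ‖fderiv ℝ (fun x => Real.sqrt (totalWeight R x) • Ψ x) x (Pi.single j 1)‖ ^ 2
        + 1 / (4 * R) * ‖Ψ x‖ ^ 2 := by
  have hS := totalWeight_pos hR x
  have hdS : DifferentiableAt ℝ (totalWeight R) x :=
    (contDiff_totalWeight hR (n := 1)).differentiable one_ne_zero x
  have hdq : ∀ y, DifferentiableAt ℝ (weightRoot R) y :=
    fun y => (hasDerivAt_weightRoot hR y).differentiableAt
  set s' := fderiv ℝ (fun x : ι → ℝ => Real.sqrt (totalWeight R x)) x (Pi.single j 1) with hs'
  -- Both sides are half the derivative of `w(x_j)`, so the cross terms of the two expanded squares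
  -- agree exactly and only `‖Ψ‖²` terms are left over.
  have hss : Real.sqrt (totalWeight R x) * s' = weightRoot R (x j) * deriv (weightRoot R) (x j) := by
    have hsq : Real.sqrt (totalWeight R x) ≠ 0 := (Real.sqrt_pos.2 hS).ne'
    have hq := (weightRoot_pos hR (x j)).ne'
    rw [hs', fderiv_sqrt hdS hS.ne', smul_apply, fderiv_totalWeight_single hR,
      (hasDerivAt_weight hR _).deriv, (hasDerivAt_weightRoot hR _).deriv, smul_eq_mul]
    field_simp
  have hR' := deriv_weightRoot_sq_le hR (x j)
  rw [fderiv_fun_smul (hdS.sqrt hS.ne') hΨ]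
  have hk : ∀ k, ‖fderiv ℝ (fun x => weightRoot R (x k) • Ψ x) x (Pi.single j 1)‖ ^ 2 =
      weight R (x k) * ‖fderiv ℝ Ψ x (Pi.single j 1)‖ ^ 2 + (if k = j then
        2 * (weightRoot R (x j) * deriv (weightRoot R) (x j))
          * inner ℝ (fderiv ℝ Ψ x (Pi.single j 1)) (Ψ x)
          + deriv (weightRoot R) (x j) ^ 2 * ‖Ψ x‖ ^ 2 else 0) := by
    intro k
    have hdk : DifferentiableAt ℝ (fun x : ι → ℝ => weightRoot R (x k)) x :=
      (contDiff_comp_eval (contDiff_weightRoot hR (n := 1)) k).differentiable one_ne_zero x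
    rw [fderiv_fun_smul hdk hΨ]
    simp only [add_apply, smul_apply,
      ContinuousLinearMap.smulRight_apply]
    rw [fderiv_comp_eval_single (hdq (x k)), norm_smul_add_smul_sq, weightRoot_sq hR]
    split_ifs with h
    · subst h; ring
    · ring
  rw [Finset.sum_congr rfl (fun k _ => hk k), Finset.sum_add_distrib, ← Finset.sum_mul,
    Finset.sum_ite_eq' Finset.univ j]
  simp only [add_apply, smul_apply,
      ContinuousLinearMap.smulRight_apply, Finset.mem_univ, if_true]
  rw [← hs', norm_smul_add_smul_sq, hss, Real.sq_sqrt hS.le]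
  change totalWeight R x * _ + _ ≤ _
  have h1 : deriv (weightRoot R) (x j) ^ 2 * ‖Ψ x‖ ^ 2 ≤ 1 / (4 * R) * ‖Ψ x‖ ^ 2 := by gcongr
  have h2 : 0 ≤ s' ^ 2 * ‖Ψ x‖ ^ 2 := by positivity
  linarith

end Localization

/-! ### Lower bound on the kinetic energy -/

section Kinetic

variable {ι : Type} [Fintype ι] [LinearOrder ι]

lemma integral_fderiv_apply_eq_zero {F : (ι → ℝ) → ℝ} (hF : ContDiff ℝ 1 F)
    (hc : HasCompactSupport F) (v : ι → ℝ) : ∫ x, fderiv ℝ F x v = 0 := by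
  have hi : Integrable (fun x => fderiv ℝ F x v) :=
    ((hF.continuous_fderiv one_ne_zero).clm_apply continuous_const).integrable_of_hasCompactSupport
      (hc.fderiv_apply ℝ v)
  have h := integral_mul_fderiv_eq_neg_fderiv_mul_of_integrable (μ := volume)
    (f := fun _ : ι → ℝ => (1 : ℝ)) (g := F) (v := v) (by simp) (by simpa using hi)
    (by simpa using hF.continuous.integrable_of_hasCompactSupport hc)
    (fun x _ => differentiableAt_const _) (fun x _ => hF.differentiable one_ne_zero x)
  simpa using h

lemma hasCompactSupport_norm_sq {E F : Type*} [TopologicalSpace E] [NormedAddCommGroup F]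
    {f : E → F} (hc : HasCompactSupport f) : HasCompactSupport (fun x => ‖f x‖ ^ 2) := by
  have : (fun x => ‖f x‖ ^ 2) = fun x => ‖f x‖ * ‖f x‖ := by ext; ring
  rw [this]
  exact hc.norm.mul_left

lemma integrable_mul_norm_sq {Ψ : (ι → ℝ) → ℂ} (hΨ : Continuous Ψ) (hc : HasCompactSupport Ψ)
    {F : (ι → ℝ) → ℝ} (hF : Continuous F) : Integrable (fun x => F x * ‖Ψ x‖ ^ 2) :=
  (hF.mul (hΨ.norm.pow 2)).integrable_of_hasCompactSupport (hasCompactSupport_norm_sq hc).mul_left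

lemma integrable_norm_fderiv_sq {Ψ : (ι → ℝ) → ℂ} (hΨ : ContDiff ℝ 1 Ψ)
    (hc : HasCompactSupport Ψ) (v : ι → ℝ) : Integrable (fun x => ‖fderiv ℝ Ψ x v‖ ^ 2) :=
  (((hΨ.continuous_fderiv one_ne_zero).clm_apply continuous_const).norm.pow
    2).integrable_of_hasCompactSupport (hasCompactSupport_norm_sq (hc.fderiv_apply ℝ v))

/-- The kinetic energy in one coordinate dominates every potential of Riccati form `g' - g²`. -/
lemma integral_riccati_le {Ψ : (ι → ℝ) → ℂ} (hΨ : ContDiff ℝ 1 Ψ) (hc : HasCompactSupport Ψ)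
    {g : ℝ → ℝ} (hg : ContDiff ℝ 1 g) (k : ι) :
    ∫ x, (deriv g (x k) - g (x k) ^ 2) * ‖Ψ x‖ ^ 2 ≤
      ∫ x, ‖fderiv ℝ Ψ x (Pi.single k 1)‖ ^ 2 := by
  have hgk : ContDiff ℝ 1 (fun x : ι → ℝ => g (x k)) := contDiff_comp_eval hg k
  have hF : ContDiff ℝ 1 (fun x => g (x k) * ‖Ψ x‖ ^ 2) := hgk.mul (hΨ.norm_sq ℝ)
  have hFc : HasCompactSupport (fun x => g (x k) * ‖Ψ x‖ ^ 2) :=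
    (hasCompactSupport_norm_sq hc).mul_left
  have h0 := integral_fderiv_apply_eq_zero hF hFc (Pi.single k 1)
  have hpt : ∀ x, fderiv ℝ (fun x => g (x k) * ‖Ψ x‖ ^ 2) x (Pi.single k 1) =
      g (x k) * (2 * inner ℝ (fderiv ℝ Ψ x (Pi.single k 1)) (Ψ x))
        + deriv g (x k) * ‖Ψ x‖ ^ 2 := by
    intro x
    have hd := (hΨ.differentiable one_ne_zero x).hasFDerivAt
    rw [fderiv_fun_mul (hgk.differentiable one_ne_zero x)
      ((hΨ.norm_sq ℝ).differentiable one_ne_zero x), hd.norm_sq.fderiv]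
    simp only [add_apply, smul_apply, smul_eq_mul,
      ContinuousLinearMap.comp_apply, innerSL_apply_apply]
    rw [fderiv_comp_eval_single (hg.differentiable one_ne_zero (x k)), if_pos rfl,
      real_inner_comm]
    simp
    ring
  have hi1 : Integrable (fun x => fderiv ℝ (fun x => g (x k) * ‖Ψ x‖ ^ 2) x (Pi.single k 1)) :=
    ((hF.continuous_fderiv one_ne_zero).clm_apply continuous_const).integrable_of_hasCompactSupport
      (hFc.fderiv_apply ℝ _)
  have hi2 : Integrable (fun x => (deriv g (x k) - g (x k) ^ 2) * ‖Ψ x‖ ^ 2) :=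
    integrable_mul_norm_sq hΨ.continuous hc
      (((hg.continuous_deriv le_rfl).comp (continuous_apply k)).sub (hgk.continuous.pow 2))
  rw [← add_zero (∫ x, ‖fderiv ℝ Ψ x (Pi.single k 1)‖ ^ 2), ← h0,
    ← integral_add (integrable_norm_fderiv_sq hΨ hc _) hi1]
  refine integral_mono hi2 ((integrable_norm_fderiv_sq hΨ hc _).add hi1) (fun x => ?_)
  have h := norm_smul_add_smul_sq 1 (g (x k)) (fderiv ℝ Ψ x (Pi.single k 1)) (Ψ x)
  -- Completing the square: the cross term of `‖∂_kΨ + gΨ‖²` is `∂_k(g‖Ψ‖²) - g'‖Ψ‖²`, whose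
  -- divergence part integrates to zero.
  have h' := sq_nonneg ‖(1 : ℝ) • fderiv ℝ Ψ x (Pi.single k 1) + g (x k) • Ψ x‖
  rw [h] at h'
  simp only [hpt]
  nlinarith

end Kinetic

/-! ### The variational bound without normalization -/

section Homogeneity

variable {ι : Type} [Fintype ι] [LinearOrder ι] {M Z e : ℝ} {Vt : ι → ℝ → ℝ}
  {Wt : ι → ι → ℝ → ℝ}

lemma energy_smul (c : ℝ) {Φ : (ι → ℝ) → ℂ} (hΦ : ContDiff ℝ ∞ Φ) :
    energy M Z Vt Wt (fun x => c • Φ x) = c ^ 2 * energy M Z Vt Wt Φ := by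
  unfold energy
  rw [← integral_const_mul]
  congr 1
  ext x
  have hd : DifferentiableAt ℝ Φ x := hΦ.differentiable (by simp) x
  have h : ∀ j, ‖fderiv ℝ (fun x => c • Φ x) x (Pi.single j 1)‖ ^ 2 =
      c ^ 2 * ‖fderiv ℝ Φ x (Pi.single j 1)‖ ^ 2 := by
    intro j
    rw [fderiv_fun_const_smul hd, smul_apply, norm_smul, mul_pow, Real.norm_eq_abs, sq_abs]
  rw [Finset.sum_congr rfl (fun j _ => h j), ← Finset.mul_sum, norm_smul, mul_pow,
    Real.norm_eq_abs, sq_abs]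
  ring

lemma mul_integral_le_energy (he : (e : EReal) ≤ groundEnergy M Z Vt Wt) {Φ : (ι → ℝ) → ℂ}
    (hΦ : ContDiff ℝ ∞ Φ) (hc : HasCompactSupport Φ)
    (hi : Integrable (fun x => potential Z Vt Wt x * ‖Φ x‖ ^ 2)) :
    e * ∫ x, ‖Φ x‖ ^ 2 ≤ energy M Z Vt Wt Φ := by
  have hn : 0 ≤ ∫ x, ‖Φ x‖ ^ 2 := integral_nonneg (fun x => by positivity)
  rcases hn.eq_or_lt with h0 | hpos
  -- A function of norm zero cannot be normalized, but continuity makes it vanish identically.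
  · have hint : Integrable (fun x => ‖Φ x‖ ^ 2) := by
      simpa using integrable_mul_norm_sq hΦ.continuous hc (continuous_const (y := (1 : ℝ)))
    have hz : (fun x => ‖Φ x‖ ^ 2) = fun _ => 0 :=
      ((hΦ.continuous.norm.pow 2).ae_eq_iff_eq volume continuous_const).1
        ((integral_eq_zero_iff_of_nonneg (fun x => by positivity) hint).1 h0.symm)
    have hΦ0 : Φ = fun _ => 0 := by
      ext1 x
      simpa using congrFun hz x
    subst hΦ0
    simp [energy]
  · set n := ∫ x, ‖Φ x‖ ^ 2 with hndef
    set c := (Real.sqrt n)⁻¹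
    have hc2 : c ^ 2 = n⁻¹ := by rw [inv_pow, Real.sq_sqrt hn]
    have hnorm : ∀ x, ‖c • Φ x‖ ^ 2 = c ^ 2 * ‖Φ x‖ ^ 2 := fun x => by
      rw [norm_smul, mul_pow, Real.norm_eq_abs, sq_abs]
    have htrial : IsTrial Z Vt Wt (fun x => c • Φ x) :=
      { contDiff := hΦ.const_smul c
        hasCompactSupport := hc.smul_left (f := fun _ => c)
        integrable := by
          refine (hi.const_mul (c ^ 2)).congr (.of_forall (fun x => ?_))
          simp only [hnorm]
          ring
        norm_eq_one := by
          simp only [hnorm]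
          rw [integral_const_mul, hc2, ← hndef, inv_mul_cancel₀ hpos.ne'] }
    have h : (e : EReal) ≤ (energy M Z Vt Wt (fun x => c • Φ x) : EReal) :=
      he.trans (iInf₂_le _ htrial)
    rw [EReal.coe_le_coe_iff, energy_smul c hΦ, hc2, inv_mul_eq_div, le_div_iff₀ hpos] at h
    exact h

end Homogeneity

/-! ### Separating one coordinate -/

section Splitting

variable {ι : Type} [LinearOrder ι]

/-- The configuration with `k`-th coordinate `t` and remaining coordinates `y`. -/
def glue (k : ι) (y : {j : ι // j ≠ k} → ℝ) (t : ℝ) : ι → ℝ :=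
  fun j => if h : j = k then t else y ⟨j, h⟩

lemma glue_self (k : ι) (y : {j : ι // j ≠ k} → ℝ) (t : ℝ) : glue k y t k = t := by simp [glue]

lemma glue_coe (k : ι) (y : {j : ι // j ≠ k} → ℝ) (t : ℝ) (j : {j : ι // j ≠ k}) :
    glue k y t j = y j := by simp [glue, j.2]

/-- Separation of the `k`-th coordinate. -/
def splitEquiv (k : ι) : (ι → ℝ) ≃ᵐ ({j : ι // j ≠ k} → ℝ) × ℝ where
  toFun x := (fun j => x j, x k)
  invFun p := glue k p.1 p.2
  left_inv x := by
    ext j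
    by_cases h : j = k
    · subst h; simp [glue]
    · simp [glue, h]
  right_inv p := by
    ext j
    · exact glue_coe k p.1 p.2 j
    · exact glue_self k p.1 p.2
  measurable_toFun := by
    simp only [Equiv.coe_fn_mk]
    fun_prop
  measurable_invFun := by
    refine measurable_pi_lambda _ (fun j => ?_)
    simp only [Equiv.coe_fn_symm_mk, glue]
    split_ifs
    · fun_prop
    · fun_prop

lemma measurePreserving_splitEquiv [Fintype ι] (k : ι) : MeasurePreserving (splitEquiv k) := by
  let _ : Unique {j : ι // ¬ j ≠ k} := ⟨⟨⟨k, by simp⟩⟩, fun j => Subtype.ext (not_not.1 j.2)⟩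
  have h1 := volume_preserving_piEquivPiSubtypeProd (fun _ : ι => ℝ) (fun j => j ≠ k)
  have h2 : MeasurePreserving (Prod.map (id : ({j : ι // j ≠ k} → ℝ) → _)
      (MeasurableEquiv.funUnique {j : ι // ¬ j ≠ k} ℝ)) volume volume :=
    (MeasurePreserving.id _).prod
      (by convert volume_preserving_funUnique {j : ι // ¬ j ≠ k} ℝ)
  exact h2.comp h1

lemma integral_glue [Fintype ι] (k : ι) (G : (ι → ℝ) → ℝ) :
    ∫ p : ({j : ι // j ≠ k} → ℝ) × ℝ, G (glue k p.1 p.2) = ∫ x, G x :=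
  (measurePreserving_splitEquiv k).symm.integral_comp' G

lemma integrable_glue [Fintype ι] (k : ι) {G : (ι → ℝ) → ℝ} (hG : Integrable G) :
    Integrable (fun p : ({j : ι // j ≠ k} → ℝ) × ℝ => G (glue k p.1 p.2)) :=
  ((measurePreserving_splitEquiv k).symm.integrable_comp_emb
    (MeasurableEquiv.measurableEmbedding _)).2 hG

/-- The linear part of `glue` in the remaining coordinates. -/
noncomputable def glueCLM (k : ι) : ({j : ι // j ≠ k} → ℝ) →L[ℝ] (ι → ℝ) :=
  ContinuousLinearMap.pi (fun j => if h : j = k then 0 else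
    ContinuousLinearMap.proj (R := ℝ) (φ := fun _ : {j : ι // j ≠ k} => ℝ) ⟨j, h⟩)

lemma glue_eq (k : ι) (y : {j : ι // j ≠ k} → ℝ) (t : ℝ) :
    glue k y t = glueCLM k y + Pi.single k t := by
  ext j
  by_cases h : j = k
  · subst h; simp [glue, glueCLM]
  · simp [glue, glueCLM, h]

lemma glueCLM_single (k : ι) [DecidableEq {j : ι // j ≠ k}] (j : {j : ι // j ≠ k}) :
    glueCLM k (Pi.single j 1) = Pi.single (j : ι) 1 := by
  ext i
  by_cases h : i = k
  · subst h; simp [glueCLM, j.2.symm]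
  · by_cases hij : i = j
    · subst hij; simp [glueCLM, j.2]
    · have : (⟨i, h⟩ : {j : ι // j ≠ k}) ≠ j := fun hh => hij (congrArg Subtype.val hh)
      simp [glueCLM, h, hij, this]

lemma hasFDerivAt_glue [Fintype ι] (k : ι) (y : {j : ι // j ≠ k} → ℝ) (t : ℝ) :
    HasFDerivAt (fun y => glue k y t) (glueCLM k) y := by
  have : (fun y => glue k y t) = fun y => glueCLM k y + Pi.single k t := by
    ext1 y; exact glue_eq k y t
  rw [this]
  exact (glueCLM k).hasFDerivAt.add_const _

lemma contDiff_glue [Fintype ι] (k : ι) (t : ℝ) {n : WithTop ℕ∞} : ContDiff ℝ n (fun y => glue k y t) := by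
  have : (fun y => glue k y t) = fun y => glueCLM k y + Pi.single k t := by
    ext1 y; exact glue_eq k y t
  rw [this]
  exact (glueCLM k).contDiff.add contDiff_const

/-- Ensures that slices of compactly supported functions are compactly supported. -/
lemma isClosedEmbedding_glue [Fintype ι] (k : ι) (t : ℝ) :
    Topology.IsClosedEmbedding (fun y => glue k y t) := by
  refine Topology.IsClosedEmbedding.of_continuous_injective_isClosedMap
    (contDiff_glue k t (n := 0)).continuous ?_ ?_
  · intro y y' h
    ext j
    rw [← glue_coe k y t j, ← glue_coe k y' t j]
    exact congrFun h j
  · intro s hs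
    have : (fun y => glue k y t) '' s =
        (fun x (j : {j : ι // j ≠ k}) => x j) ⁻¹' s ∩ {x | x k = t} := by
      ext x
      constructor
      · rintro ⟨y, hy, rfl⟩
        refine ⟨?_, glue_self k y t⟩
        simpa only [Set.mem_preimage, glue_coe] using hy
      · rintro ⟨hx, hxt⟩
        refine ⟨_, hx, ?_⟩
        have hxt : x k = t := hxt
        ext j
        by_cases h : j = k
        · subst h; simp [glue, hxt]
        · simp [glue, h]
    rw [this]
    exact (hs.preimage (by fun_prop)).inter (isClosed_eq (continuous_apply k) continuous_const)

end Splitting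

/-! ### Splitting the potential at one particle -/

section Decomposition

variable {ι : Type} [Fintype ι] [LinearOrder ι]

/-- The interaction of an ordered pair, zero unless `j < l`. -/
def pairTerm (Wt : ι → ι → ℝ → ℝ) (j l : ι) (x : ι → ℝ) : ℝ :=
  if j < l then Wt j l (x j - x l) else 0

/-- The part of the potential that involves the particle `k`. -/
def potentialOf (Z : ℝ) (Vt : ι → ℝ → ℝ) (Wt : ι → ι → ℝ → ℝ) (k : ι) (x : ι → ℝ) : ℝ :=
  -Z * Vt k (x k) + ∑ j, (pairTerm Wt k j x + pairTerm Wt j k x)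

/-- The part of the potential that does not involve the particle `k`. -/
def potentialWithout (Z : ℝ) (Vt : ι → ℝ → ℝ) (Wt : ι → ι → ℝ → ℝ) (k : ι) (x : ι → ℝ) : ℝ :=
  potential (ι := {j : ι // j ≠ k}) Z (fun j => Vt j) (fun i j => Wt i j) (fun j => x j)

lemma potential_eq_sum_pairTerm (Z : ℝ) (Vt : ι → ℝ → ℝ) (Wt : ι → ι → ℝ → ℝ) (x : ι → ℝ) :
    potential Z Vt Wt x = (∑ j, -Z * Vt j (x j)) + ∑ j, ∑ l, pairTerm Wt j l x := by
  simp only [potential, Finset.sum_filter, pairTerm]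

lemma sum_eq_add_sum_ne (k : ι) (f : ι → ℝ) :
    ∑ j, f j = f k + ∑ j : {j : ι // j ≠ k}, f j := by
  rw [Fintype.sum_eq_add_sum_subtype_ne f k]

lemma potential_eq_without_add_of (Z : ℝ) (Vt : ι → ℝ → ℝ) (Wt : ι → ι → ℝ → ℝ) (k : ι)
    (x : ι → ℝ) :
    potential Z Vt Wt x = potentialWithout Z Vt Wt k x + potentialOf Z Vt Wt k x := by
  have hkk : pairTerm Wt k k x = 0 := by simp [pairTerm]
  have hsub : potentialWithout Z Vt Wt k x = (∑ j : {j : ι // j ≠ k}, -Z * Vt j (x j)) +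
      ∑ j : {j : ι // j ≠ k}, ∑ l : {j : ι // j ≠ k}, pairTerm Wt j l x := by
    rw [potentialWithout, potential_eq_sum_pairTerm]
    rfl
  rw [hsub, potential_eq_sum_pairTerm, potentialOf, sum_eq_add_sum_ne k,
    sum_eq_add_sum_ne k (fun j => ∑ l, pairTerm Wt j l x),
    Finset.sum_congr rfl (fun (j : {j : ι // j ≠ k}) _ =>
      sum_eq_add_sum_ne k (fun l => pairTerm Wt j l x)),
    Finset.sum_add_distrib, Finset.sum_add_distrib,
    sum_eq_add_sum_ne k (fun l => pairTerm Wt l k x), hkk]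
  ring

end Decomposition

/-! ### Energy bounds with one particle removed -/

section Slicing

variable {ι : Type} [Fintype ι] [LinearOrder ι] {M Z e : ℝ} {Vt : ι → ℝ → ℝ}
  {Wt : ι → ι → ℝ → ℝ}

/-- For almost every fixed value of `x_k` the slice of `ψ` is admissible, up to normalization, in
the problem without particle `k`. The slicewise bound is then integrated by Fubini. -/
lemma mul_integral_le_of_le_groundEnergyWithout {k : ι}
    (he : (e : EReal) ≤ groundEnergyWithout M Z Vt Wt k) {ψ : (ι → ℝ) → ℂ}
    (hψ : ContDiff ℝ ∞ ψ) (hc : HasCompactSupport ψ)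
    (hi : Integrable (fun x => potentialWithout Z Vt Wt k x * ‖ψ x‖ ^ 2)) :
    e * ∫ x, ‖ψ x‖ ^ 2 ≤
      ∫ x, ((1 / M) * ∑ j : {j : ι // j ≠ k}, ‖fderiv ℝ ψ x (Pi.single (j : ι) 1)‖ ^ 2
        + potentialWithout Z Vt Wt k x * ‖ψ x‖ ^ 2) := by
  have hψ1 : ContDiff ℝ 1 ψ := hψ.of_le (by exact_mod_cast le_top)
  have hn : Integrable (fun x => ‖ψ x‖ ^ 2) := by
    simpa using integrable_mul_norm_sq hψ.continuous hc (continuous_const (y := (1 : ℝ)))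
  have hK : Integrable (fun x => (1 / M) *
      ∑ j : {j : ι // j ≠ k}, ‖fderiv ℝ ψ x (Pi.single (j : ι) 1)‖ ^ 2) :=
    (integrable_finsetSum _ (fun j _ => integrable_norm_fderiv_sq hψ1 hc _)).const_mul _
  have hG : Integrable (fun x => (1 / M) *
      ∑ j : {j : ι // j ≠ k}, ‖fderiv ℝ ψ x (Pi.single (j : ι) 1)‖ ^ 2
        + potentialWithout Z Vt Wt k x * ‖ψ x‖ ^ 2 - e * ‖ψ x‖ ^ 2) :=
    (hK.fun_add hi).sub (hn.const_mul e)
  rw [← integral_const_mul, ← sub_nonneg, ← integral_sub (hK.fun_add hi) (hn.const_mul e),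
    ← integral_glue k, Measure.volume_eq_prod,
    integral_prod_symm _ (integrable_glue k hG)]
  have hi' := integrable_glue k hi
  rw [Measure.volume_eq_prod] at hi'
  refine integral_nonneg_of_ae (hi'.prod_left_ae.mono (fun t ht => ?_))
  have hpot : ∀ y, potentialWithout Z Vt Wt k (glue k y t) =
      potential (ι := {j : ι // j ≠ k}) Z (fun j => Vt j) (fun i j => Wt i j) y := by
    intro y
    simp only [potentialWithout, glue_coe]
  simp only [hpot] at ht
  have hφ : ContDiff ℝ ∞ (fun y => ψ (glue k y t)) := hψ.comp (contDiff_glue k t)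
  have hφ1 : ContDiff ℝ 1 (fun y => ψ (glue k y t)) := hφ.of_le (by exact_mod_cast le_top)
  have hφc : HasCompactSupport (fun y => ψ (glue k y t)) :=
    hc.comp_isClosedEmbedding (isClosedEmbedding_glue k t)
  have hφn : Integrable (fun y => ‖ψ (glue k y t)‖ ^ 2) := by
    simpa using integrable_mul_norm_sq hφ.continuous hφc (continuous_const (y := (1 : ℝ)))
  have h := mul_integral_le_energy (M := M) (Z := Z) (Vt := fun j : {j : ι // j ≠ k} => Vt j)
    (Wt := fun i j => Wt i j) he hφ hφc ht
  -- Stated for every decidability instance so that it also rewrites the `Pi.single` occurring in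
  -- `energy` on the subtype.
  have hder : ∀ [DecidableEq {j : ι // j ≠ k}] y (j : {j : ι // j ≠ k}),
      fderiv ℝ (fun y => ψ (glue k y t)) y (Pi.single j 1) =
      fderiv ℝ ψ (glue k y t) (Pi.single (j : ι) 1) := by
    intro _ y j
    have := (hψ1.differentiable one_ne_zero (glue k y t)).hasFDerivAt.comp y
      (hasFDerivAt_glue k y t)
    change fderiv ℝ (ψ ∘ fun y => glue k y t) y (Pi.single j 1) = _
    rw [this.fderiv, ContinuousLinearMap.comp_apply, glueCLM_single]
  rw [← sub_nonneg, energy, ← integral_const_mul, ← integral_sub] at h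
  · simp only [hder] at h
    simpa only [hpot, Pi.zero_apply] using h
  · exact ((integrable_finsetSum _
      (fun j _ => integrable_norm_fderiv_sq hφ1 hφc _)).const_mul _).add ht
  · exact hφn.const_mul e

/-- Energy bound for a function whose `k`-th particle is split off: the kinetic energy of that
particle is traded for the Riccati potential `g' - g²`. -/
lemma integral_le_integral_of_le_groundEnergyWithout (hM : 0 < M) {k : ι}
    (he : (e : EReal) ≤ groundEnergyWithout M Z Vt Wt k) {ψ : (ι → ℝ) → ℂ}
    (hψ : ContDiff ℝ ∞ ψ) (hc : HasCompactSupport ψ)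
    (hi : Integrable (fun x => potentialWithout Z Vt Wt k x * ‖ψ x‖ ^ 2))
    (hi' : Integrable (fun x => potentialOf Z Vt Wt k x * ‖ψ x‖ ^ 2))
    {g : ℝ → ℝ} (hg : ContDiff ℝ 1 g) :
    ∫ x, (e * ‖ψ x‖ ^ 2 + (1 / M * (deriv g (x k) - g (x k) ^ 2) * ‖ψ x‖ ^ 2
        + potentialOf Z Vt Wt k x * ‖ψ x‖ ^ 2)) ≤
      ∫ x, ((1 / M) * ∑ j, ‖fderiv ℝ ψ x (Pi.single j 1)‖ ^ 2
        + potential Z Vt Wt x * ‖ψ x‖ ^ 2) := by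
  have hψ1 : ContDiff ℝ 1 ψ := hψ.of_le (by exact_mod_cast le_top)
  have h1 := mul_integral_le_of_le_groundEnergyWithout he hψ hc hi
  have h2 := mul_le_mul_of_nonneg_left (integral_riccati_le hψ1 hc hg k)
    (by positivity : 0 ≤ 1 / M)
  have hn : Integrable (fun x => ‖ψ x‖ ^ 2) := by
    simpa using integrable_mul_norm_sq hψ.continuous hc (continuous_const (y := (1 : ℝ)))
  have hK : ∀ j, Integrable (fun x => ‖fderiv ℝ ψ x (Pi.single j 1)‖ ^ 2) :=
    fun j => integrable_norm_fderiv_sq hψ1 hc _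
  have hgi : Integrable (fun x => 1 / M * (deriv g (x k) - g (x k) ^ 2) * ‖ψ x‖ ^ 2) :=
    integrable_mul_norm_sq hψ.continuous hc (continuous_const.mul
      (((hg.continuous_deriv le_rfl).comp (continuous_apply k)).sub
        ((hg.continuous.comp (continuous_apply k)).pow 2)))
  have hR : ∀ x, (1 / M) * ∑ j, ‖fderiv ℝ ψ x (Pi.single j 1)‖ ^ 2
        + potential Z Vt Wt x * ‖ψ x‖ ^ 2 =
      ((1 / M) * ∑ j : {j : ι // j ≠ k}, ‖fderiv ℝ ψ x (Pi.single (j : ι) 1)‖ ^ 2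
        + potentialWithout Z Vt Wt k x * ‖ψ x‖ ^ 2) +
      ((1 / M) * ‖fderiv ℝ ψ x (Pi.single k 1)‖ ^ 2 + potentialOf Z Vt Wt k x * ‖ψ x‖ ^ 2) := by
    intro x
    rw [potential_eq_without_add_of Z Vt Wt k, sum_eq_add_sum_ne k]
    ring
  simp only [hR]
  have hKs : Integrable (fun x => (1 / M) *
      ∑ j : {j : ι // j ≠ k}, ‖fderiv ℝ ψ x (Pi.single (j : ι) 1)‖ ^ 2) :=
    (integrable_finsetSum _ (fun j _ => hK _)).const_mul _
  rw [integral_add (hKs.fun_add hi) (((hK k).const_mul _).fun_add hi'),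
    integral_add ((hK k).const_mul _) hi', integral_add (hn.const_mul e) (hgi.fun_add hi'),
    integral_add hgi hi', integral_const_mul, integral_const_mul]
  rw [← integral_const_mul] at h2
  simp only [← mul_assoc] at h2
  linarith

end Slicing

/-! ### Integrability of the separate potential terms -/

section Integrability

lemma measurable_pairTerm {ι : Type} [LinearOrder ι] {Wt : ι → ι → ℝ → ℝ}
    (hW : ∀ j l, j < l → Measurable (Wt j l)) (j l : ι) :
    Measurable (pairTerm Wt j l) := by
  unfold pairTerm
  split_ifs with h
  · exact (hW j l h).comp ((measurable_pi_apply j).sub (measurable_pi_apply l))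
  · exact measurable_const

variable {ι : Type} [Fintype ι]

lemma ae_sub_ne_zero : ∀ᵐ x : ι → ℝ, ∀ j l, j ≠ l → x j - x l ≠ 0 := by
  classical
  rw [ae_all_iff]
  intro j
  rw [ae_all_iff]
  intro l
  by_cases hjl : j = l
  · simp [hjl]
  set L : (ι → ℝ) →ₗ[ℝ] ℝ :=
    LinearMap.proj (R := ℝ) (φ := fun _ : ι => ℝ) j - LinearMap.proj l with hL
  have hne : LinearMap.ker L ≠ ⊤ := by
    intro h
    have h1 : (Pi.single j 1 : ι → ℝ) ∈ LinearMap.ker L := h ▸ Submodule.mem_top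
    have hlj : l ≠ j := fun h => hjl h.symm
    simp [hL, hlj] at h1
  have h0 := Measure.addHaar_submodule volume _ hne
  refine (measure_eq_zero_iff_ae_notMem.1 h0).mono (fun x hx _ hzero => hx ?_)
  simpa [hL] using hzero

/-- On a cube containing the support of `φ`, `v(x_k)` is a product of integrable one-variable
functions, all but one equal to `1`; the factor `φ` is bounded. -/
lemma integrable_comp_eval_mul {v : ℝ → ℝ} (hv : LocallyIntegrable v) (k : ι)
    {φ : (ι → ℝ) → ℝ} (hφ : Continuous φ) (hc : HasCompactSupport φ) :
    Integrable (fun x => v (x k) * φ x) := by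
  classical
  obtain ⟨r, hr⟩ := hc.isCompact.isBounded.subset_closedBall (0 : ι → ℝ)
  obtain ⟨C, hC⟩ := hc.exists_bound_of_continuous hφ
  set f : ι → ℝ → ℝ := fun i => (Set.Icc (-r) r).indicator (if i = k then v else fun _ => 1) with hf
  have hfi : ∀ i, Integrable (f i) := by
    intro i
    rw [hf, integrable_indicator_iff measurableSet_Icc]
    split_ifs
    · exact hv.integrableOn_isCompact isCompact_Icc
    · exact integrableOn_const (by simp)
  have hP : Integrable (fun x : ι → ℝ => ∏ i, f i (x i)) := Integrable.fintype_prod hfi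
  refine (hP.bdd_mul (c := C) hφ.aestronglyMeasurable (.of_forall hC)).congr
    (.of_forall (fun x => ?_))
  by_cases hx : x ∈ tsupport φ
  · have hmem : ∀ i, x i ∈ Set.Icc (-r) r := by
      intro i
      have h := mem_closedBall_zero_iff.1 (hr hx)
      exact abs_le.1 ((norm_le_pi_norm x i).trans h)
    have : ∏ i, f i (x i) = v (x k) := by
      have h1 : ∀ i, f i (x i) = if i = k then v (x k) else 1 := by
        intro i
        rw [hf]
        simp only [Set.indicator_of_mem (hmem i)]
        by_cases hik : i = k
        · simp [hik]
        · simp [hik]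
      rw [Finset.prod_congr rfl (fun i _ => h1 i), Finset.prod_ite_eq' Finset.univ k]
      simp
    simp only [this]
    ring
  · simp [image_eq_zero_of_notMem_tsupport hx]

variable [LinearOrder ι] {Z : ℝ} {Vt : ι → ℝ → ℝ} {Wt : ι → ι → ℝ → ℝ}

lemma ae_pairTerm_nonneg (hW : ∀ j l, j < l → ∀ t, t ≠ 0 → 0 ≤ Wt j l t) :
    ∀ᵐ x : ι → ℝ, ∀ j l, 0 ≤ pairTerm Wt j l x := by
  filter_upwards [ae_sub_ne_zero (ι := ι)] with x hx j l
  unfold pairTerm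
  split_ifs with h
  · exact hW j l h _ (hx j l h.ne)
  · exact le_rfl

/-- Finite potential energy is known only for the total potential, and the interactions may be
singular on the diagonals. Subtracting the integrable one-particle terms leaves a sum of almost
everywhere nonnegative pair terms, which dominates each of them. -/
lemma integrable_pairTerm (hV : ∀ j, LocallyIntegrable (Vt j))
    (hWm : ∀ j l, j < l → Measurable (Wt j l))
    (hW : ∀ j l, j < l → ∀ t, t ≠ 0 → 0 ≤ Wt j l t) {φ : (ι → ℝ) → ℝ} (hφ : Continuous φ)
    (hc : HasCompactSupport φ) (hφ0 : ∀ x, 0 ≤ φ x)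
    (hi : Integrable (fun x => potential Z Vt Wt x * φ x)) (j l : ι) :
    Integrable (fun x => pairTerm Wt j l x * φ x) := by
  have hVi : Integrable (fun x => ∑ j, -Z * (Vt j (x j) * φ x)) :=
    integrable_finsetSum _ (fun j _ => (integrable_comp_eval_mul (hV j) j hφ hc).const_mul _)
  refine (hi.sub hVi).mono' ((measurable_pairTerm hWm j l).aestronglyMeasurable.mul
    hφ.aestronglyMeasurable) ?_
  filter_upwards [ae_pairTerm_nonneg hW] with x hx
  have hle : pairTerm Wt j l x ≤ ∑ j, ∑ l, pairTerm Wt j l x :=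
    (Finset.single_le_sum (f := fun l => pairTerm Wt j l x) (fun l _ => hx j l)
      (Finset.mem_univ l)).trans
      (Finset.single_le_sum (f := fun j => ∑ l, pairTerm Wt j l x)
        (fun j _ => Finset.sum_nonneg (fun l _ => hx j l)) (Finset.mem_univ j))
  have heq : potential Z Vt Wt x * φ x - ∑ j, -Z * (Vt j (x j) * φ x) =
      (∑ j, ∑ l, pairTerm Wt j l x) * φ x := by
    rw [potential_eq_sum_pairTerm, add_mul, Finset.sum_mul]
    simp only [mul_assoc]
    ring
  rw [Real.norm_of_nonneg (mul_nonneg (hx j l) (hφ0 x)), Pi.sub_apply, heq]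
  exact mul_le_mul_of_nonneg_right hle (hφ0 x)

end Integrability

/-! ### Repulsion against attraction and localization error -/

section Positivity

variable {ι : Type} [Fintype ι] [LinearOrder ι] {R b Z t : ℝ} {Vt : ι → ℝ → ℝ}
  {Wt : ι → ι → ℝ → ℝ}

lemma sum_lt_half : ∑ j : ι, ∑ l : ι, (if j < l then (1 / 2 : ℝ) else 0) =
    (Fintype.card ι : ℝ) * (Fintype.card ι - 1) / 4 := by
  have h1 : ∑ j : ι, ∑ l : ι, (if j < l then (1 / 2 : ℝ) else 0) =
      ∑ j : ι, ∑ l : ι, (if l < j then (1 / 2 : ℝ) else 0) := Finset.sum_comm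
  have h2 : ∀ j l : ι, (if j < l then (1 / 2 : ℝ) else 0) + (if l < j then (1 / 2 : ℝ) else 0) =
      1 / 2 - (if j = l then (1 / 2 : ℝ) else 0) := by
    intro j l
    rcases lt_trichotomy j l with h | h | h
    · simp [h, h.not_gt, h.ne]
    · simp [h]
    · simp [h, h.not_gt, h.ne']
  have h3 : ∑ j : ι, ∑ l : ι, (if j < l then (1 / 2 : ℝ) else 0) +
      ∑ j : ι, ∑ l : ι, (if l < j then (1 / 2 : ℝ) else 0) =
      (Fintype.card ι : ℝ) * (Fintype.card ι - 1) / 2 := by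
    simp only [← Finset.sum_add_distrib, h2]
    simp
    ring
  linarith

/-- Regrouping by pairs gives each interaction the factor `w(x_j) + w(x_l)`, so each of the
`N(N-1)/2` pairs contributes at least `1/2`. -/
lemma le_sum_weight_mul_pairTerm (ht : 0 ≤ t) (htR : t ≤ 4 * R ^ 2) (hR : 0 < R)
    (hW : ∀ j l, j < l → ∀ s, s ≠ 0 → 1 / (2 * Real.sqrt (s ^ 2 + t)) ≤ Wt j l s)
    {x : ι → ℝ} (hx : ∀ j l, j ≠ l → x j - x l ≠ 0) :
    (Fintype.card ι : ℝ) * (Fintype.card ι - 1) / 4 ≤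
      ∑ k, weight R (x k) * ∑ j, (pairTerm Wt k j x + pairTerm Wt j k x) := by
  have h1 : ∑ k, weight R (x k) * ∑ j, (pairTerm Wt k j x + pairTerm Wt j k x) =
      ∑ j, ∑ l, (weight R (x j) + weight R (x l)) * pairTerm Wt j l x := by
    simp only [Finset.mul_sum, mul_add, add_mul, Finset.sum_add_distrib]
    congr 1
    exact Finset.sum_comm
  rw [h1, ← sum_lt_half]
  refine Finset.sum_le_sum (fun j _ => Finset.sum_le_sum (fun l _ => ?_))
  unfold pairTerm
  split_ifs with h
  · have hne := hx j l h.ne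
    refine (half_le_weight_add_weight_mul ht htR hR hne).trans ?_
    exact mul_le_mul_of_nonneg_left (hW j l h _ hne)
      (add_pos (weight_pos hR _) (weight_pos hR _)).le
  · simp

lemma localization_error_le (hb : 0 < b) (hZ : 0 ≤ Z) (hR : 1 ≤ R) (ht : 0 ≤ t)
    (htR : t ≤ 4 * R ^ 2) (hV : ∀ j s, Vt j s ≤ 2 / Real.sqrt (1 + s ^ 2))
    (hW : ∀ j l, j < l → ∀ s, s ≠ 0 → 1 / (2 * Real.sqrt (s ^ 2 + t)) ≤ Wt j l s)
    (hN : b / R + 16 * Z * Real.log (2 * R + 1) + 16 * Z ^ 2 * Real.log (2 * R + 1) ^ 2 * R / b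
      ≤ (Fintype.card ι : ℝ) - 1)
    {x : ι → ℝ} (hx : ∀ j l, j ≠ l → x j - x l ≠ 0) :
    (Fintype.card ι : ℝ) * (b * (1 / (4 * R))) ≤
      ∑ k, weight R (x k) * (b * (deriv (fun y => 2 * Z / b * damp R y) (x k)
        - (2 * Z / b * damp R (x k)) ^ 2) + potentialOf Z Vt Wt k x) := by
  have hR0 : 0 < R := by linarith
  have hpair := le_sum_weight_mul_pairTerm ht htR hR0 hW hx
  set C := 4 * Z * Real.log (2 * R + 1) + 4 * Z ^ 2 * Real.log (2 * R + 1) ^ 2 * R / b with hC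
  have hone : ∀ k, -C ≤ weight R (x k) * (b * (deriv (fun y => 2 * Z / b * damp R y) (x k)
        - (2 * Z / b * damp R (x k)) ^ 2) - Z * Vt k (x k)) := by
    intro k
    have h1 := weight_mul_attraction_le hb hZ hR (x k)
    have h2 : weight R (x k) * (Z * Vt k (x k)) ≤
        weight R (x k) * (Z * (2 / Real.sqrt (1 + x k ^ 2))) :=
      mul_le_mul_of_nonneg_left (mul_le_mul_of_nonneg_left (hV k _) hZ) (weight_pos hR0 _).le
    linarith
  have hsum := Finset.sum_le_sum (fun k (_ : k ∈ (Finset.univ : Finset ι)) => hone k)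
  rw [Finset.sum_const, Finset.card_univ, nsmul_eq_mul] at hsum
  have hsplit : ∀ k, weight R (x k) * (b * (deriv (fun y => 2 * Z / b * damp R y) (x k)
        - (2 * Z / b * damp R (x k)) ^ 2) + potentialOf Z Vt Wt k x) =
      weight R (x k) * (b * (deriv (fun y => 2 * Z / b * damp R y) (x k)
        - (2 * Z / b * damp R (x k)) ^ 2) - Z * Vt k (x k)) +
      weight R (x k) * ∑ j, (pairTerm Wt k j x + pairTerm Wt j k x) := by
    intro k
    rw [potentialOf]
    ring
  rw [Finset.sum_congr rfl (fun k _ => hsplit k), Finset.sum_add_distrib]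
  have hN0 : (0 : ℝ) ≤ Fintype.card ι := Nat.cast_nonneg _
  have h4 : b * (1 / (4 * R)) + C ≤ ((Fintype.card ι : ℝ) - 1) / 4 := by
    have : b * (1 / (4 * R)) + C = (b / R + 16 * Z * Real.log (2 * R + 1)
        + 16 * Z ^ 2 * Real.log (2 * R + 1) ^ 2 * R / b) / 4 := by
      rw [hC]; field_simp; ring
    rw [this]
    linarith
  have := mul_le_mul_of_nonneg_left h4 hN0
  linarith

end Positivity

/-! ### The criterion for absence of bound states -/

section Binding

variable {ι : Type} [Fintype ι] [LinearOrder ι] {M R Z t e : ℝ} {Vt : ι → ℝ → ℝ}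
  {Wt : ι → ι → ℝ → ℝ}

lemma hasCompactSupport_smul {E : Type*} [TopologicalSpace E] {f : E → ℂ}
    (hf : HasCompactSupport f) (a : E → ℝ) : HasCompactSupport (fun x => a x • f x) :=
  hf.smul_left (f := a)

lemma le_energy_of_isTrial [Nonempty ι] (hM : 0 < M) (hZ : 0 ≤ Z) (hR : 1 ≤ R) (ht : 0 ≤ t)
    (htR : t ≤ 4 * R ^ 2) (hVl : ∀ j, LocallyIntegrable (Vt j))
    (hWm : ∀ j l, j < l → Measurable (Wt j l))
    (hV : ∀ j s, Vt j s ≤ 2 / Real.sqrt (1 + s ^ 2))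
    (hW : ∀ j l, j < l → ∀ s, s ≠ 0 → 1 / (2 * Real.sqrt (s ^ 2 + t)) ≤ Wt j l s)
    (hN : 1 / M / R + 16 * Z * Real.log (2 * R + 1)
      + 16 * Z ^ 2 * Real.log (2 * R + 1) ^ 2 * R / (1 / M) ≤ (Fintype.card ι : ℝ) - 1)
    (he : ∀ k, (e : EReal) ≤ groundEnergyWithout M Z Vt Wt k) {Φ : (ι → ℝ) → ℂ}
    (hΦ : IsTrial Z Vt Wt Φ) : e ≤ energy M Z Vt Wt Φ := by
  have hR0 : 0 < R := by linarith
  have hS : ∀ x : ι → ℝ, 0 < totalWeight R x := totalWeight_pos hR0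
  have hc := hΦ.hasCompactSupport
  have hroot : ContDiff ℝ ∞ (fun x : ι → ℝ => Real.sqrt (totalWeight R x)) :=
    (contDiff_totalWeight hR0).sqrt (fun x => (hS x).ne')
  have hroot0 : ∀ x : ι → ℝ, Real.sqrt (totalWeight R x) ≠ 0 :=
    fun x => (Real.sqrt_pos.2 (hS x)).ne'
  obtain ⟨Ψ, hΨdef⟩ : ∃ Ψ : (ι → ℝ) → ℂ,
      Ψ = fun x => (Real.sqrt (totalWeight R x))⁻¹ • Φ x := ⟨_, rfl⟩
  have hΨ : ContDiff ℝ ∞ Ψ := by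
    rw [hΨdef]
    exact (hroot.inv hroot0).smul hΦ.contDiff
  have hΨc : HasCompactSupport Ψ := by
    rw [hΨdef]
    exact hasCompactSupport_smul hc _
  have hΦeq : Φ = fun x => Real.sqrt (totalWeight R x) • Ψ x := by
    ext1 x
    simp only [hΨdef]
    rw [smul_inv_smul₀ (hroot0 x)]
  have hΨn : ∀ x, ‖Φ x‖ ^ 2 = totalWeight R x * ‖Ψ x‖ ^ 2 := by
    intro x
    rw [congrFun hΦeq x, norm_smul, mul_pow, Real.norm_eq_abs, sq_abs, Real.sq_sqrt (hS x).le]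
  obtain ⟨ψ, hψdef⟩ : ∃ ψ : ι → (ι → ℝ) → ℂ,
      ∀ k, ψ k = fun x => weightRoot R (x k) • Ψ x := ⟨_, fun _ => rfl⟩
  have hψ : ∀ k, ContDiff ℝ ∞ (ψ k) :=
    fun k => hψdef k ▸ (contDiff_comp_eval (contDiff_weightRoot hR0) k).smul hΨ
  have hψc : ∀ k, HasCompactSupport (ψ k) := fun k => hψdef k ▸ hasCompactSupport_smul hΨc _
  have hψn : ∀ k x, ‖ψ k x‖ ^ 2 = weight R (x k) * ‖Ψ x‖ ^ 2 := by
    intro k x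
    simp only [hψdef]
    rw [norm_smul, mul_pow, Real.norm_eq_abs, sq_abs, weightRoot_sq hR0]
  have hψΦ : ∀ k x, ‖ψ k x‖ ^ 2 = weight R (x k) / totalWeight R x * ‖Φ x‖ ^ 2 := by
    intro k x
    rw [hψn, hΨn, ← mul_assoc, div_mul_cancel₀ _ (hS x).ne']
  have hW0 : ∀ j l, j < l → ∀ s, s ≠ 0 → 0 ≤ Wt j l s :=
    fun j l h s hs => le_trans (by positivity) (hW j l h s hs)
  -- Localization preserves integrability because `‖ψ_k‖²` is `‖Φ‖²` times the continuous factor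
  -- `w(x_k)/S ≤ 1`.
  have hpair : ∀ k j l, Integrable (fun x => pairTerm Wt j l x * ‖ψ k x‖ ^ 2) := by
    intro k j l
    have h := integrable_pairTerm (φ := fun x => ‖Φ x‖ ^ 2) hVl hWm hW0
      (hΦ.contDiff.continuous.norm.pow 2)
      (hasCompactSupport_norm_sq hc) (fun x => by positivity) hΦ.integrable j l
    have hcont : Continuous (fun x : ι → ℝ => weight R (x k) / totalWeight R x) :=
      (contDiff_comp_eval (contDiff_weight hR0 (n := 0)) k).continuous.div
        (contDiff_totalWeight hR0 (n := 0)).continuous (fun x => (hS x).ne')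
    refine (h.bdd_mul (c := 1) hcont.aestronglyMeasurable (.of_forall (fun x => ?_))).congr
      (.of_forall (fun x => ?_))
    · have hk : weight R (x k) ≤ totalWeight R x :=
        Finset.single_le_sum (f := fun k => weight R (x k)) (fun k _ => (weight_pos hR0 _).le)
          (Finset.mem_univ k)
      rw [Real.norm_of_nonneg (div_nonneg (weight_pos hR0 _).le (hS x).le)]
      exact (div_le_one (hS x)).2 hk
    · simp only [hψΦ]
      ring
  have hVi : ∀ k j, Integrable (fun x => Vt j (x j) * ‖ψ k x‖ ^ 2) := fun k j =>
    integrable_comp_eval_mul (hVl j) j ((hψ k).continuous.norm.pow 2)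
      (hasCompactSupport_norm_sq (hψc k))
  have hpot : ∀ k, Integrable (fun x => potential Z Vt Wt x * ‖ψ k x‖ ^ 2) := by
    intro k
    have h := (integrable_finsetSum Finset.univ (fun j _ => (hVi k j).const_mul (-Z))).fun_add
      (integrable_finsetSum Finset.univ (fun j _ =>
        integrable_finsetSum Finset.univ (fun l _ => hpair k j l)))
    refine h.congr (.of_forall (fun x => ?_))
    simp only [potential_eq_sum_pairTerm, add_mul, Finset.sum_mul, mul_assoc]
  have hof : ∀ k, Integrable (fun x => potentialOf Z Vt Wt k x * ‖ψ k x‖ ^ 2) := by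
    intro k
    have h := ((hVi k k).const_mul (-Z)).fun_add (integrable_finsetSum Finset.univ
      (fun j _ => (hpair k k j).fun_add (hpair k j k)))
    refine h.congr (.of_forall (fun x => ?_))
    simp only [potentialOf, add_mul, Finset.sum_mul, mul_assoc]
  have hwithout : ∀ k, Integrable (fun x => potentialWithout Z Vt Wt k x * ‖ψ k x‖ ^ 2) := by
    intro k
    refine ((hpot k).sub (hof k)).congr (.of_forall (fun x => ?_))
    simp only [Pi.sub_apply, potential_eq_without_add_of Z Vt Wt k x]
    ring
  obtain ⟨g, hgdef⟩ : ∃ g : ℝ → ℝ, g = fun y => 2 * Z / (1 / M) * damp R y := ⟨_, rfl⟩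
  have hg : ContDiff ℝ 1 g := hgdef ▸ contDiff_const.mul (contDiff_damp hR0)
  have hψ1 : ∀ k, ContDiff ℝ 1 (ψ k) := fun k => (hψ k).of_le (by exact_mod_cast le_top)
  have hnorm : ∀ {f : (ι → ℝ) → ℂ}, Continuous f → HasCompactSupport f →
      Integrable (fun x => ‖f x‖ ^ 2) := fun hf hfc => by
    simpa using integrable_mul_norm_sq hf hfc (continuous_const (y := (1 : ℝ)))
  have hpiece := Finset.sum_le_sum (fun k (_ : k ∈ (Finset.univ : Finset ι)) =>
    integral_le_integral_of_le_groundEnergyWithout hM (he k) (hψ k) (hψc k) (hwithout k) (hof k) hg)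
  have hLi : ∀ k, Integrable (fun x => e * ‖ψ k x‖ ^ 2
      + (1 / M * (deriv g (x k) - g (x k) ^ 2) * ‖ψ k x‖ ^ 2
        + potentialOf Z Vt Wt k x * ‖ψ k x‖ ^ 2)) := fun k =>
    ((hnorm (hψ k).continuous (hψc k)).const_mul e).fun_add
      ((integrable_mul_norm_sq (hψ k).continuous (hψc k) (continuous_const.mul
        (((hg.continuous_deriv le_rfl).comp (continuous_apply k)).sub
          ((hg.continuous.comp (continuous_apply k)).pow 2)))).fun_add (hof k))
  have hRi : ∀ k, Integrable (fun x => (1 / M) * ∑ j, ‖fderiv ℝ (ψ k) x (Pi.single j 1)‖ ^ 2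
      + potential Z Vt Wt x * ‖ψ k x‖ ^ 2) := fun k =>
    ((integrable_finsetSum _ (fun j _ =>
      integrable_norm_fderiv_sq (hψ1 k) (hψc k) _)).const_mul _).fun_add (hpot k)
  rw [← integral_finsetSum _ (fun k _ => hLi k), ← integral_finsetSum _ (fun k _ => hRi k)]
    at hpiece
  obtain ⟨c, hcdef⟩ : ∃ c : ℝ, c = (Fintype.card ι : ℝ) * (1 / M * (1 / (4 * R))) := ⟨_, rfl⟩
  have hEi : Integrable (fun x => (1 / M) * ∑ j, ‖fderiv ℝ Φ x (Pi.single j 1)‖ ^ 2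
      + potential Z Vt Wt x * ‖Φ x‖ ^ 2) :=
    ((integrable_finsetSum _ (fun j _ => integrable_norm_fderiv_sq
      (hΦ.contDiff.of_le (by exact_mod_cast le_top)) hc _)).const_mul _).fun_add hΦ.integrable
  have hΨi : Integrable (fun x => c * ‖Ψ x‖ ^ 2) := (hnorm hΨ.continuous hΨc).const_mul c
  have hΦi : Integrable (fun x => e * ‖Φ x‖ ^ 2) :=
    (hnorm hΦ.contDiff.continuous hc).const_mul e
  have hupper : ∫ x, ∑ k, ((1 / M) * ∑ j, ‖fderiv ℝ (ψ k) x (Pi.single j 1)‖ ^ 2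
      + potential Z Vt Wt x * ‖ψ k x‖ ^ 2) ≤ energy M Z Vt Wt Φ + ∫ x, c * ‖Ψ x‖ ^ 2 := by
    rw [energy, ← integral_add hEi hΨi]
    refine integral_mono (integrable_finsetSum _ (fun k _ => hRi k)) (hEi.add hΨi) (fun x => ?_)
    have hIMS := Finset.sum_le_sum (fun j (_ : j ∈ (Finset.univ : Finset ι)) =>
      sum_norm_fderiv_sq_le hR0 (hΨ.differentiable (by simp) x) j)
    rw [Finset.sum_comm, Finset.sum_add_distrib, Finset.sum_const, Finset.card_univ, nsmul_eq_mul,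
      ← hΦeq] at hIMS
    simp only [← hψdef] at hIMS
    have h2 := mul_le_mul_of_nonneg_left hIMS (by positivity : 0 ≤ 1 / M)
    have h3 : ∑ k, potential Z Vt Wt x * ‖ψ k x‖ ^ 2 = potential Z Vt Wt x * ‖Φ x‖ ^ 2 := by
      rw [← Finset.mul_sum, hΨn, totalWeight, Finset.sum_mul]
      simp only [hψn]
    simp only [Finset.sum_add_distrib, ← Finset.mul_sum]
    rw [← Finset.mul_sum] at h3
    rw [h3, hcdef]
    linarith
  have hlower : e + ∫ x, c * ‖Ψ x‖ ^ 2 ≤ ∫ x, ∑ k, (e * ‖ψ k x‖ ^ 2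
      + (1 / M * (deriv g (x k) - g (x k) ^ 2) * ‖ψ k x‖ ^ 2
        + potentialOf Z Vt Wt k x * ‖ψ k x‖ ^ 2)) := by
    have h1 : e = ∫ x, e * ‖Φ x‖ ^ 2 := by
      rw [integral_const_mul, hΦ.norm_eq_one, mul_one]
    nth_rewrite 1 [h1]
    rw [← integral_add hΦi hΨi]
    refine integral_mono_ae (hΦi.add hΨi) (integrable_finsetSum _ (fun k _ => hLi k)) ?_
    filter_upwards [ae_sub_ne_zero (ι := ι)] with x hx
    have hpos := mul_le_mul_of_nonneg_right
      (localization_error_le (by positivity : 0 < 1 / M) hZ hR ht htR hV hW hN hx)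
      (by positivity : 0 ≤ ‖Ψ x‖ ^ 2)
    have hsum : ∑ k, (e * ‖ψ k x‖ ^ 2 + (1 / M * (deriv g (x k) - g (x k) ^ 2) * ‖ψ k x‖ ^ 2
        + potentialOf Z Vt Wt k x * ‖ψ k x‖ ^ 2)) = e * ‖Φ x‖ ^ 2 +
        (∑ k, weight R (x k) * (1 / M * (deriv g (x k) - g (x k) ^ 2)
          + potentialOf Z Vt Wt k x)) * ‖Ψ x‖ ^ 2 := by
      rw [hΨn, totalWeight, Finset.sum_mul, Finset.sum_mul, Finset.mul_sum,
        ← Finset.sum_add_distrib]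
      refine Finset.sum_congr rfl (fun k _ => ?_)
      rw [hψn]
      ring
    rw [hsum]
    simp only [hgdef, hcdef]
    exact add_le_add le_rfl hpos
  linarith

theorem not_hasBoundState_of_card_ge [Nonempty ι] (hM : 0 < M) (hZ : 0 ≤ Z) (hR : 1 ≤ R)
    (ht : 0 ≤ t) (htR : t ≤ 4 * R ^ 2) (hVl : ∀ j, LocallyIntegrable (Vt j))
    (hWm : ∀ j l, j < l → Measurable (Wt j l))
    (hV : ∀ j s, Vt j s ≤ 2 / Real.sqrt (1 + s ^ 2))
    (hW : ∀ j l, j < l → ∀ s, s ≠ 0 → 1 / (2 * Real.sqrt (s ^ 2 + t)) ≤ Wt j l s)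
    (hN : 1 / M / R + 16 * Z * Real.log (2 * R + 1)
      + 16 * Z ^ 2 * Real.log (2 * R + 1) ^ 2 * R / (1 / M) ≤ (Fintype.card ι : ℝ) - 1) :
    ¬ HasBoundState M Z Vt Wt := by
  intro hB
  -- The reduced energies may differ, and the localized pieces need one real `e` below all of them;
  -- minimality of `k₀` provides it, even if some energy is infinite.
  obtain ⟨k₀, hk₀⟩ := Finite.exists_min (groundEnergyWithout M Z Vt Wt)
  obtain ⟨e, he, he'⟩ := EReal.lt_iff_exists_real_btwn.1 (hB k₀)
  simp only [groundEnergy, iInf_lt_iff] at he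
  obtain ⟨Φ, hΦ, hlt⟩ := he
  have := le_energy_of_isTrial hM hZ hR ht htR hVl hWm hV hW hN
    (fun k => he'.le.trans (hk₀ k)) hΦ
  exact absurd (EReal.coe_lt_coe_iff.1 hlt) (not_lt.2 this)

end Binding

/-! ### Choice of the localization scale -/

section Parameters

/-- The binding condition holds at the localization scale `R = 4 b / N + D`. -/
lemma scale_condition {N b Z D : ℝ} (hN : 4 ≤ N) (hb : 0 < b) (hZ : 0 ≤ Z) (hD : 1 ≤ D)
    (h1 : 256 * (Z * Real.log (2 * (4 * b / N + D) + 1)) ≤ N)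
    (h2 : 64 * (Z * Real.log (2 * (4 * b / N + D) + 1)) ^ 2 * D ≤ N * b) :
    b / (4 * b / N + D) + 16 * Z * Real.log (2 * (4 * b / N + D) + 1)
      + 16 * Z ^ 2 * Real.log (2 * (4 * b / N + D) + 1) ^ 2 * (4 * b / N + D) / b ≤ N - 1 := by
  have hN0 : 0 < N := by linarith
  have hq : 0 < 4 * b / N := by positivity
  set l := Real.log (2 * (4 * b / N + D) + 1) with hl
  have hl0 : 0 ≤ Z * l := mul_nonneg hZ (Real.log_nonneg (by linarith))
  -- The four terms are at most `N/4`, `N/16`, `N/16` and `N/4`; their sum `5N/8` is below `N - 1`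
  -- since `N ≥ 4`.
  have t1 : b / (4 * b / N + D) ≤ N / 4 := by
    rw [div_le_div_iff₀ (by positivity) (by norm_num)]
    have : N * (4 * b / N + D) = 4 * b + N * D := by field_simp
    nlinarith
  have t2 : 16 * Z ^ 2 * l ^ 2 * (4 * b / N + D) / b = 64 * (Z * l) ^ 2 / N
      + 16 * (Z * l) ^ 2 * D / b := by
    field_simp
    ring
  have t3 : 64 * (Z * l) ^ 2 / N ≤ N / 16 := by
    rw [div_le_iff₀ hN0]
    nlinarith
  have t4 : 16 * (Z * l) ^ 2 * D / b ≤ N / 4 := by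
    rw [div_le_iff₀ hb]
    linarith
  rw [t2]
  linarith

lemma log_le_two_mul_sqrt {x : ℝ} (hx : 0 ≤ x) : Real.log x ≤ 2 * Real.sqrt x := by
  have h := Real.log_le_rpow_div hx (by norm_num : (0 : ℝ) < 1 / 2)
  rw [← Real.sqrt_eq_rpow] at h
  linarith

lemma log_sq_le_sqrt {x : ℝ} (hx : 1 ≤ x) : Real.log x ^ 2 ≤ 16 * Real.sqrt x := by
  have hx0 : 0 ≤ x := by linarith
  have h := log_le_two_mul_sqrt (Real.sqrt_nonneg x)
  rw [Real.log_sqrt hx0] at h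
  have h0 := Real.log_nonneg hx
  have h1 : Real.log x ≤ 4 * Real.sqrt (Real.sqrt x) := by linarith
  calc Real.log x ^ 2 ≤ (4 * Real.sqrt (Real.sqrt x)) ^ 2 := by gcongr
    _ = _ := by rw [mul_pow, Real.sq_sqrt (Real.sqrt_nonneg x)]; norm_num

/-- Applied with `p = γ - 2`; this is where `γ > 3` is needed when `ν` may grow with `N`. -/
lemma exists_rpow_mul_log_sq_le (C : ℝ) {p : ℝ} (hp : 1 < p) :
    ∃ u₀ : ℝ, 1 ≤ u₀ ∧ ∀ u, u₀ ≤ u → C * (u ^ (1 / p) * Real.log u ^ 2) ≤ u := by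
  have hp1 : 1 / p < 1 := (div_lt_one (by linarith)).2 hp
  have h := (isLittleO_log_rpow_rpow_atTop 2 (by linarith : 0 < 1 - 1 / p)).bound
    (by positivity : (0 : ℝ) < 1 / (|C| + 1))
  obtain ⟨u₁, hu₁⟩ := Filter.eventually_atTop.1 h
  refine ⟨max 1 u₁, le_max_left _ _, fun u hu => ?_⟩
  have hu1 : 1 ≤ u := (le_max_left _ _).trans hu
  have hu0 : 0 < u := by linarith
  have hb := hu₁ u ((le_max_right _ _).trans hu)
  rw [Real.rpow_two, Real.norm_of_nonneg (sq_nonneg _),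
    Real.norm_of_nonneg (Real.rpow_nonneg hu0.le _)] at hb
  have hsplit : u ^ (1 / p) * u ^ (1 - 1 / p) = u := by
    rw [← Real.rpow_add hu0]; simp
  calc C * (u ^ (1 / p) * Real.log u ^ 2)
      ≤ (|C| + 1) * (u ^ (1 / p) * (1 / (|C| + 1) * u ^ (1 - 1 / p))) := by
        gcongr
        linarith [le_abs_self C]
    _ = u ^ (1 / p) * u ^ (1 - 1 / p) := by field_simp
    _ = u := hsplit

variable {N Z u D D₀ : ℝ}

/-- Logarithmic bounds at the localization scale when the length `D` stays bounded. -/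
lemma scale_bounds_of_le_const (hZ : 1 ≤ Z) (hNZ : Z ≤ N) (hD₀ : 1 ≤ D₀) (hD : 1 ≤ D)
    (hDle : D ≤ D₀) (hu : 16 * D₀ ^ 2 ≤ u) (hN : 2 ^ 20 * Z * (2 * Real.log u) ≤ N) :
    256 * (Z * Real.log (2 * (4 * (u * Z) / N + D) + 1)) ≤ N ∧
      64 * (Z * Real.log (2 * (4 * (u * Z) / N + D) + 1)) ^ 2 * D ≤ N * (u * Z) := by
  have hN0 : 0 < N := by linarith
  have hu16 : 16 ≤ u := by nlinarith
  have hlog : 0 ≤ Real.log u := Real.log_nonneg (by linarith)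
  have hq : 4 * (u * Z) / N ≤ 4 * u := by
    rw [div_le_iff₀ hN0]; nlinarith
  have hq0 : 0 < 4 * (u * Z) / N := by positivity
  set l := Real.log (2 * (4 * (u * Z) / N + D) + 1) with hl
  have hl0 : 0 ≤ l := Real.log_nonneg (by linarith)
  have hlu : l ≤ 2 * Real.log u := by
    rw [hl, ← show Real.log (u ^ 2) = 2 * Real.log u by rw [Real.log_pow]; norm_num]
    refine Real.log_le_log (by linarith) ?_
    nlinarith
  have h1 : 256 * (Z * l) ≤ N := by
    have : Z * l ≤ Z * (2 * Real.log u) := by gcongr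
    have h0 : 0 ≤ Z * (2 * Real.log u) := by positivity
    linarith
  refine ⟨h1, ?_⟩
  have hsu : D₀ ≤ Real.sqrt u := Real.le_sqrt_of_sq_le (by nlinarith)
  have hlD : l * D ≤ 4 * u := by
    calc l * D ≤ (2 * (2 * Real.sqrt u)) * Real.sqrt u :=
          mul_le_mul (hlu.trans (by linarith [log_le_two_mul_sqrt (by linarith : 0 ≤ u)]))
            (hDle.trans hsu) (by linarith) (by positivity)
      _ = 4 * (Real.sqrt u * Real.sqrt u) := by ring
      _ = 4 * u := by rw [Real.mul_self_sqrt (by linarith)]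
  have hZl : 0 ≤ Z * l := by positivity
  calc 64 * (Z * l) ^ 2 * D = 256 * (Z * l) * (Z * (l * D)) / 4 := by ring
    _ ≤ N * (Z * (4 * u)) / 4 := by gcongr
    _ = N * (u * Z) := by ring

/-- Logarithmic bounds at the localization scale when `D` grows at most like `√N`. -/
lemma scale_bounds_of_le_sqrt (hZ : 1 ≤ Z) (hNZ : Z ≤ N) (hD₀ : 1 ≤ D₀) (hD : 1 ≤ D)
    (hDle : D ≤ D₀ * Real.sqrt N) (hu : 4096 * D₀ ≤ u) (hZu : (4096 * D₀) ^ 2 * Z ≤ u ^ 2)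
    (hlogu : 4096 * D₀ * (Real.sqrt Z * Real.log u ^ 2) ≤ u)
    (hN : 2 ^ 20 * Z * (2 * Real.log u) ≤ N) :
    256 * (Z * Real.log (2 * (4 * (u * Z) / N + D) + 1)) ≤ N ∧
      64 * (Z * Real.log (2 * (4 * (u * Z) / N + D) + 1)) ^ 2 * D ≤ N * (u * Z) := by
  have hN0 : 0 < N := by linarith
  have hZ0 : 0 < Z := by linarith
  have hu0 : 4096 ≤ u := by linarith
  have hlog : 1 ≤ 2 * Real.log u := by
    have : 1 ≤ Real.log u := by
      rw [Real.le_log_iff_exp_le (by linarith)]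
      linarith [Real.exp_one_lt_d9]
    linarith
  have hq : 4 * (u * Z) / N ≤ 4 * u := by
    rw [div_le_iff₀ hN0]; nlinarith
  have hq0 : 0 < 4 * (u * Z) / N := by positivity
  set l := Real.log (2 * (4 * (u * Z) / N + D) + 1) with hl
  have hl0 : 0 ≤ l := Real.log_nonneg (by linarith)
  -- `N` has no upper bound in terms of `u`, so `log N` enters `l`. Its part `log Z` is controlled
  -- by `log u`, and `log n` is absorbed by powers of `n`.
  obtain ⟨n, hn⟩ : ∃ n, n = N / Z := ⟨_, rfl⟩
  have hNn : N = n * Z := by rw [hn]; field_simp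
  have hnlog : 2 ^ 20 * (2 * Real.log u) ≤ n := by
    rw [hn, le_div_iff₀ hZ0]; linarith
  have hn20 : 2 ^ 20 ≤ n := by linarith
  have hn1 : 1 ≤ n := by linarith
  have hsN : 1 ≤ Real.sqrt N := Real.one_le_sqrt.2 (by linarith)
  have hlogZ : Real.log Z ≤ 2 * Real.log u := by
    rw [← show Real.log (u ^ 2) = 2 * Real.log u by rw [Real.log_pow]; norm_num]
    refine Real.log_le_log hZ0 (le_trans ?_ hZu)
    have : 1 ≤ (4096 * D₀) ^ 2 := by nlinarith
    nlinarith
  have hlu : l ≤ 4 * Real.log u + Real.log n := by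
    have h1 : l ≤ Real.log (u ^ 2 * Real.sqrt N) := by
      refine Real.log_le_log (by linarith) ?_
      have h2 : (10 + 2 * D₀) * u ≤ u ^ 2 := by nlinarith
      have h3 : (10 + 2 * D₀) * u * Real.sqrt N ≤ u ^ 2 * Real.sqrt N := by gcongr
      have h4 : 9 * u ≤ 9 * u * Real.sqrt N := le_mul_of_one_le_right (by linarith) hsN
      have h5 : 1 * (D₀ * Real.sqrt N) ≤ u * (D₀ * Real.sqrt N) := by gcongr; linarith
      nlinarith
    rw [Real.log_mul (by positivity) (by positivity), Real.log_pow, Real.log_sqrt hN0.le, hNn,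
      Real.log_mul (by linarith) hZ0.ne'] at h1
    have h6 := Real.log_nonneg hn1
    push_cast at h1
    linarith
  have hsqn : 2 ^ 10 ≤ Real.sqrt n := Real.le_sqrt_of_sq_le (by norm_num; linarith)
  have hss : Real.sqrt n * Real.sqrt n = n := Real.mul_self_sqrt (by linarith)
  have hln : 256 * l ≤ n := by
    have h1 := log_le_two_mul_sqrt (by linarith : 0 ≤ n)
    nlinarith
  have hsn0 : 0 ≤ Real.sqrt n := Real.sqrt_nonneg n
  constructor
  · rw [hNn]
    calc 256 * (Z * l) = 256 * l * Z := by ring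
      _ ≤ n * Z := by gcongr
  · have hl2 : l ^ 2 ≤ 32 * Real.log u ^ 2 + 2 * Real.log n ^ 2 := by
      have : l ^ 2 ≤ (4 * Real.log u + Real.log n) ^ 2 := by gcongr
      nlinarith [sq_nonneg (4 * Real.log u - Real.log n)]
    have hsZ : 4096 * D₀ * Real.sqrt Z ≤ u := by
      refine abs_le_of_sq_le_sq' ?_ (by linarith) |>.2
      rw [mul_pow, Real.sq_sqrt hZ0.le]
      exact hZu
    have hmain : 64 * (Real.sqrt Z * l ^ 2 * D₀) ≤ Real.sqrt n * u := by
      have hnl := log_sq_le_sqrt hn1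
      have hsZ0 := Real.sqrt_nonneg Z
      calc 64 * (Real.sqrt Z * l ^ 2 * D₀)
          ≤ 64 * (Real.sqrt Z * (32 * Real.log u ^ 2 + 2 * (16 * Real.sqrt n)) * D₀) := by
            gcongr
            linarith
        _ = (4096 * D₀ * (Real.sqrt Z * Real.log u ^ 2)) / 2
            + (4096 * D₀ * Real.sqrt Z) * Real.sqrt n / 2 := by ring
        _ ≤ u * Real.sqrt n / 2 + u * Real.sqrt n / 2 := by
            have h1 : u ≤ u * Real.sqrt n := le_mul_of_one_le_right (by linarith) (by linarith)
            have h2 := mul_le_mul_of_nonneg_right hsZ hsn0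
            linarith
        _ = _ := by ring
    have hsNn : Real.sqrt N = Real.sqrt n * Real.sqrt Z := by
      rw [hNn, Real.sqrt_mul (by linarith)]
    have hZZ : Real.sqrt Z * Real.sqrt Z = Z := Real.mul_self_sqrt hZ0.le
    calc 64 * (Z * l) ^ 2 * D ≤ 64 * (Z * l) ^ 2 * (D₀ * (Real.sqrt n * Real.sqrt Z)) := by
          rw [← hsNn]
          gcongr
      _ = Z ^ 2 * Real.sqrt n * (64 * (Real.sqrt Z * l ^ 2 * D₀)) := by ring
      _ ≤ Z ^ 2 * Real.sqrt n * (Real.sqrt n * u) := by gcongr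
      _ = Z ^ 2 * (Real.sqrt n * Real.sqrt n) * u := by ring
      _ = N * (u * Z) := by rw [hss, hNn]; ring

end Parameters

end LandauModel

/-! ### The constants and the conclusion -/

theorem theorem2 (K γ : ℝ) :
    ∃ A > (0 : ℝ), ∃ a₂ > (0 : ℝ), ∀ ε > (0 : ℝ), ∃ aε > (0 : ℝ),
      ∀ (N μ ν : ℕ) (Z B : ℝ)
        (Vt : Fin N → ℝ → ℝ) (Wt : Fin N → Fin N → ℝ → ℝ),
        ((2 < γ ∧ (ν : ℝ) ≤ K) ∨ (3 < γ ∧ (ν : ℝ) ≤ K * N)) →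
        ν ≤ 2 * μ →
        (∀ j, Measurable (Vt j)) →
        (∀ j, LocallyIntegrable (Vt j)) →
        (∀ j k, j < k → Measurable (Wt j k)) →
        (∀ j k, j < k → LocallyIntegrableOn (Wt j k) {0}ᶜ) →
        (∀ j x, Vt j x ≤ LandauModel.V μ x) →
        (∀ j k, j < k → ∀ x, x ≠ 0 →
          (1 / Real.sqrt 2) * LandauModel.VPred ν (x / Real.sqrt 2) ≤ Wt j k x) →
        1 ≤ Z →
        a₂ * Z ^ γ ≤ B →
        B < aε * Real.exp (Z ^ (1 / 2 - ε)) →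
        3 * Z + 1 + A * Z * Real.log Z * |Real.log (Z ^ 2 / B)| < (N : ℝ) →
        ¬ LandauModel.HasBoundState (B ^ (-(1 / 2) : ℝ)) Z Vt Wt := by
  obtain ⟨u₀, hu₀1, hu₀⟩ : ∃ u₀ : ℝ, 1 ≤ u₀ ∧ (3 < γ → ∀ u, u₀ ≤ u →
      4096 * (1 + Real.sqrt |K|) * (u ^ (1 / (γ - 2)) * Real.log u ^ 2) ≤ u) := by
    by_cases hγ : 3 < γ
    · obtain ⟨u₀, h1, h2⟩ := LandauModel.exists_rpow_mul_log_sq_le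
        (4096 * (1 + Real.sqrt |K|)) (by linarith : 1 < γ - 2)
      exact ⟨u₀, h1, fun _ => h2⟩
    · exact ⟨1, le_rfl, fun h => absurd h hγ⟩
  obtain ⟨D₀, hD₀def⟩ : ∃ D₀, D₀ = 1 + Real.sqrt |K| := ⟨_, rfl⟩
  rw [← hD₀def] at hu₀
  have hD₀ : 1 ≤ D₀ := by rw [hD₀def]; linarith [Real.sqrt_nonneg |K|]
  -- `U` is a lower bound for `u = √B/Z`: the first term serves bounded `ν`, the other two serve `ν
  -- ≤ KN`.
  obtain ⟨U, hU⟩ : ∃ U, U = 16 * D₀ ^ 2 + 4096 * D₀ + u₀ := ⟨_, rfl⟩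
  have hU1 : 1 ≤ U := by nlinarith
  refine ⟨2 ^ 20, by norm_num, U ^ 2, by positivity, fun ε hε =>
    ⟨U ^ 2 * Real.exp (-2), by positivity, ?_⟩⟩
  intro N μ ν Z B Vt Wt hcase _ _ hVl hWm _ hV hW hZ hB hBlt hN
  have hγ : 2 < γ := by rcases hcase with h | h <;> linarith [h.1]
  have hZ0 : 0 < Z := by linarith
  have hZγ : 1 ≤ Z ^ γ := Real.one_le_rpow hZ (by linarith)
  have hB0 : 0 < B := lt_of_lt_of_le (by positivity) hB
  -- If `Z ≤ 4`, then `Z^(1/2-ε) ≤ 2`, and the factor `e^(-2)` in the constant makes the upper bound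
  -- on `B` at most `U²`, contradicting the lower bound.
  have hZ4 : 4 < Z := by
    by_contra! hle
    have h1 : Z ^ (1 / 2 - ε) ≤ 2 := by
      calc Z ^ (1 / 2 - ε) ≤ Z ^ (1 / 2 : ℝ) :=
            Real.rpow_le_rpow_of_exponent_le hZ (by linarith)
        _ = Real.sqrt Z := (Real.sqrt_eq_rpow Z).symm
        _ ≤ 2 := by rw [Real.sqrt_le_left (by norm_num)]; linarith
    have h2 : U ^ 2 * Real.exp (-2) * Real.exp (Z ^ (1 / 2 - ε)) ≤ U ^ 2 := by
      rw [mul_assoc, ← Real.exp_add]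
      exact mul_le_of_le_one_right (by positivity) (Real.exp_le_one_iff.2 (by linarith))
    have h3 : U ^ 2 ≤ U ^ 2 * Z ^ γ := le_mul_of_one_le_right (by positivity) hZγ
    linarith
  have hlogZ : 1 ≤ Real.log Z := by
    rw [Real.le_log_iff_exp_le hZ0]
    linarith [Real.exp_one_lt_d9]
  obtain ⟨u, hu⟩ : ∃ u, u = Real.sqrt B / Z := ⟨_, rfl⟩
  have hb : 0 < Real.sqrt B := Real.sqrt_pos.2 hB0
  have hub : Real.sqrt B = u * Z := by rw [hu]; field_simp
  have hu2 : u ^ 2 = B / Z ^ 2 := by rw [hu, div_pow, Real.sq_sqrt hB0.le]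
  have hu0 : 0 < u := by rw [hu]; positivity
  have hup : U ^ 2 * Z ^ (γ - 2) ≤ u ^ 2 := by
    rw [hu2, le_div_iff₀ (by positivity), mul_assoc,
      ← Real.rpow_two Z, ← Real.rpow_add hZ0]
    simpa using hB
  have hZp : 1 ≤ Z ^ (γ - 2) := Real.one_le_rpow hZ (by linarith)
  have huU : U ≤ u := by
    refine abs_le_of_sq_le_sq' ?_ hu0.le |>.2
    exact (le_mul_of_one_le_right (by positivity) hZp).trans hup
  have hlogu : 0 ≤ Real.log u := Real.log_nonneg (by linarith)
  have habs : |Real.log (Z ^ 2 / B)| = 2 * Real.log u := by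
    have : Z ^ 2 / B = (u ^ 2)⁻¹ := by rw [hu2, inv_div]
    rw [this, Real.log_inv, abs_neg, Real.log_pow, abs_of_nonneg (by positivity)]
    norm_num
  rw [habs] at hN
  have hN' : 2 ^ 20 * Z * (2 * Real.log u) ≤ N := by
    have h1 : 2 ^ 20 * Z * 1 * (2 * Real.log u) ≤ 2 ^ 20 * Z * Real.log Z * (2 * Real.log u) := by
      gcongr
    linarith
  have h0 : 0 ≤ 2 ^ 20 * Z * (2 * Real.log u) := by positivity
  have hNZ : 3 * Z + 1 < N := by
    have h1 : 0 ≤ 2 ^ 20 * Z * Real.log Z * (2 * Real.log u) := by positivity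
    linarith
  have hD : 1 ≤ 1 + Real.sqrt ν := by linarith [Real.sqrt_nonneg (ν : ℝ)]
  have hbounds : 256 * (Z * Real.log (2 * (4 * (u * Z) / N + (1 + Real.sqrt ν)) + 1)) ≤ N ∧
      64 * (Z * Real.log (2 * (4 * (u * Z) / N + (1 + Real.sqrt ν)) + 1)) ^ 2
        * (1 + Real.sqrt ν) ≤ N * (u * Z) := by
    rcases hcase with ⟨_, hν⟩ | ⟨hγ3, hν⟩
    · refine LandauModel.scale_bounds_of_le_const hZ (by linarith) hD₀ hD ?_ (by linarith) hN'
      rw [hD₀def]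
      gcongr
      exact hν.trans (le_abs_self K)
    · have hZpow : Z ≤ Z ^ (γ - 2) := by
        nth_rewrite 1 [← Real.rpow_one Z]
        exact Real.rpow_le_rpow_of_exponent_le hZ (by linarith)
      refine LandauModel.scale_bounds_of_le_sqrt hZ (by linarith) hD₀ hD ?_ (by nlinarith) ?_ ?_ hN'
      · have hs1 : 1 ≤ Real.sqrt N := Real.one_le_sqrt.2 (by linarith)
        have hs2 : Real.sqrt ν ≤ Real.sqrt |K| * Real.sqrt N := by
          rw [← Real.sqrt_mul (abs_nonneg K)]
          apply Real.sqrt_le_sqrt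
          exact hν.trans (by gcongr; exact le_abs_self K)
        rw [hD₀def]
        linarith
      · refine le_trans ?_ hup
        gcongr
        nlinarith
      -- The bound `Z^(γ-2) ≤ u²` turns `√Z log²u` into a power of `u` of exponent below one, times
      -- `log²u`.
      · have hsZ : Real.sqrt Z ≤ u ^ (1 / (γ - 2)) := by
          have h1 : Z ^ (γ - 2) ≤ u ^ 2 :=
            (le_mul_of_one_le_left (by positivity) (one_le_pow₀ hU1)).trans hup
          have h2 : (Real.sqrt Z) ^ (γ - 2) ≤ u := by
            refine abs_le_of_sq_le_sq' ?_ hu0.le |>.2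
            rwa [← Real.rpow_mul_natCast (Real.sqrt_nonneg Z), mul_comm (γ - 2),
              Real.rpow_mul (Real.sqrt_nonneg Z), Real.rpow_natCast, Real.sq_sqrt hZ0.le]
          calc Real.sqrt Z = ((Real.sqrt Z) ^ (γ - 2)) ^ (1 / (γ - 2)) := by
                rw [← Real.rpow_mul (Real.sqrt_nonneg Z), mul_one_div_cancel (by linarith),
                  Real.rpow_one]
            _ ≤ _ := by
                have : 0 ≤ 1 / (γ - 2) := one_div_nonneg.2 (by linarith)
                gcongr
        refine le_trans ?_ (hu₀ hγ3 u (by nlinarith))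
        gcongr
  rw [← hub] at hbounds
  have hcond := LandauModel.scale_condition (by linarith) hb hZ0.le hD hbounds.1 hbounds.2
  have hM : 1 / B ^ (-(1 / 2) : ℝ) = Real.sqrt B := by
    rw [Real.rpow_neg hB0.le, one_div, inv_inv, Real.sqrt_eq_rpow]
  have hN0 : 0 < N := by
    have : (0 : ℝ) < N := by linarith
    exact_mod_cast this
  have : Nonempty (Fin N) := ⟨⟨0, hN0⟩⟩
  have hq : 0 < 4 * Real.sqrt B / N := by positivity
  -- `t = 2ν` comes from rescaling by `√2` in `le_VPred`; the summand `1 + √ν` of `R` secures both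
  -- `R ≥ 1` and `t ≤ 4R²`.
  refine LandauModel.not_hasBoundState_of_card_ge
    (R := 4 * Real.sqrt B / N + (1 + Real.sqrt ν)) (t := 2 * ν) (by positivity) hZ0.le
    (by linarith) (by positivity) ?_ hVl hWm (fun j s => (hV j s).trans (LandauModel.V_le μ s))
    (fun j l h s hs => (LandauModel.le_VPred ν hs).trans (hW j l h s hs)) ?_
  · have h1 : Real.sqrt ν ≤ 4 * Real.sqrt B / N + (1 + Real.sqrt ν) := by linarith
    have h2 := pow_le_pow_left₀ (Real.sqrt_nonneg (ν : ℝ)) h1 2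
    rw [Real.sq_sqrt (Nat.cast_nonneg ν)] at h2
    linarith [(Nat.cast_nonneg ν : (0 : ℝ) ≤ ν)]
  · rw [hM, Fintype.card_fin]
    exact hcond
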